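/- **Notation.** For a poset $P$, let $\mathbf{Co}(P)$ be the lattice of all order-convex subsets of $P$ (including $\varnothing$), ordered by inclusion; $\mathbf{Co}(n)$ is $\mathbf{Co}$ of the $n$-element chain. A *chain* is a totally ordered set. Let $\mathbf{SUB}(\mathcal{LO})$ be the class of all lattices that embed (as sublattices) into a product $\prod_{i\in I}\mathbf{Co}(T_i)$ for some family $(T_i)_{i\in I}$ of chains. $\mathrm{J}(L)$ is the set of join-irreducible elements of $L$ (the least element is not join-irreducible). An *atom* is an element covering the least element; $L$ is *atomistic* if every element is a join of atoms; $L$ is *subdirectly irreducible* if it has a smallest nonzero congruence. Consider the following lattice identities. (HS), with $b'=b\wedge(b_0\vee b_1)$: $$\begin{aligned}a\wedge(b'\vee c)={}&(a\wedge b')\vee\bigvee_{i<2}\bigl[a\wedge((b\wedge b_i)\vee c)\bigr]\vee\bigvee_{i<2}\bigl[a\wedge((b'\wedge(a\vee b_i))\vee c)\wedge(b_i\vee c)\wedge(b\vee b_{1-i})\bigr]\\&\vee\bigvee_{i<2}\bigl[a\wedge((b'\wedge(a\vee b_i))\vee c)\wedge(b_0\vee c)\wedge(b_1\vee c)\bigr].\end{aligned}$$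 (U): $$x\wedge(x_0\vee x_1)\wedge(x_0\vee x_2)\wedge(x_1\vee x_2)=\bigl(x\wedge x_0\wedge(x_1\vee x_2)\bigr)\vee\bigl(x\wedge x_1\wedge(x_0\vee x_2)\bigr)\vee\bigl(x\wedge x_2\wedge(x_0\vee x_1)\bigr).$$ (B): $$\begin{aligned}x\wedge(a_0\vee a_1)\wedge(b_0\vee b_1)={}&\bigvee_{i<2}\bigl[(x\wedge a_i\wedge(b_0\vee b_1))\vee(x\wedge b_i\wedge(a_0\vee a_1))\bigr]\\&\vee\bigvee_{i<2}\bigl[x\wedge(a_0\vee a_1)\wedge(b_0\vee b_1)\wedge(a_0\vee b_i)\wedge(a_1\vee b_{1-i})\bigr].\end{aligned}$$ (E): $$\begin{aligned}x\wedge\bigwedge_{i<3}(a\vee b_i)={}&\bigvee_{i<3}\Bigl[x\wedge b_i\wedge\bigwedge_{j\ne i}(a\vee b_j)\Bigr]\vee\bigvee_{\sigma\in\mathfrak S_3}\bigl[x\wedge(a\vee b^*_{0,\sigma})\wedge(a\vee b^*_{1,\sigma})\wedge(a\vee b_{\sigma(2)})\bigr],\end{aligned}$$ where $\mathfrak S_3$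 is the group of permutations of $\{0,1,2\}$, $b^*_{0,\sigma}=b_{\sigma(0)}\wedge(x\vee b_{\sigma(1)})$ and $b^*_{1,\sigma}=b_{\sigma(1)}\wedge(x\vee b_{\sigma(2)})\wedge(b_{\sigma(0)}\vee b_{\sigma(2)})$. (P), with $b'=b\wedge(b_0\vee b_1)$: $$\begin{aligned}a\wedge(b'\vee c)\wedge(c\vee d)={}&\bigl(a\wedge b'\wedge(c\vee d)\bigr)\vee\bigl(a\wedge d\wedge(b'\vee c)\bigr)\vee\bigl[a\wedge((b'\wedge(a\vee d))\vee c)\wedge(c\vee d)\bigr]\\&\vee\bigvee_{i<2}\bigl[a\wedge(b_i\vee c)\wedge((b'\wedge(a\vee b_i)\wedge(b_i\vee d))\vee c)\wedge(c\vee d)\bigr].\end{aligned}$$ **Theorem.** For a lattice $L$, the following are equivalent: 1. $L$ belongs to $\mathbf{SUB}(\mathcal{LO})$. 2. $L$ satisfies the identities (HS), (U), (B), (E) and (P). 3. There is a lattice embedding $\varphi\colon L\hookrightarrow\prod_{i\in I}\mathbf{Co}(T_i)$, for some family $(T_i)_{i\in I}$ of chains, which preserves the least and the greatest element whenever they exist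 in $L$, and such that: - if $L$ is finite, then $\sum_{i\in I}|T_i|\le|\mathrm{J}(L)|^2$; - if $L$ is subdirectly irreducible, then $I=\{0\}$ is a singleton, $\varphi$ sends atoms to atoms, and, if $L$ is moreover finite, $|T_0|=|\mathrm{J}(L)|$; - if $L$ is finite, atomistic and subdirectly irreducible, then $L\cong\mathbf{Co}(n)$, where $n=|\mathrm{J}(L)|$. Consequently, $\mathbf{SUB}(\mathcal{LO})$ is a finitely based variety of lattices (it is the class of all lattices satisfying a certain finite set of identities); in particular, it is closed under homomorphic images. -/

import Mathlib

universe u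

/-! ### Lattices of order-convex subsets -/

/-- `Co P`: the set of all order-convex subsets of the poset `P` (the empty set included). -/
def Co (P : Type u) [PartialOrder P] : Type u := {X : Set P // X.OrdConnected}

namespace Co

variable {P : Type u} [PartialOrder P]

/-- Order-convex subsets are ordered by inclusion. -/
instance : PartialOrder (Co P) := inferInstanceAs (PartialOrder {X : Set P // X.OrdConnected})

/-- The order-convex hull of a subset. -/
def hull (S : Set P) : Co P :=
  ⟨{z | ∃ x ∈ S, ∃ y ∈ S, x ≤ z ∧ z ≤ y}, by
    refine ⟨?_⟩
    rintro p ⟨x, hx, _, _, hxp, _⟩ q ⟨_, _, y, hy, _, hqy⟩ z ⟨hpz, hzq⟩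
    exact ⟨x, hx, y, hy, hxp.trans hpz, hzq.trans hqy⟩⟩

/-- Meet is intersection, join is the order-convex hull of the union. -/
instance : Lattice (Co P) where
  inf X Y := ⟨X.1 ∩ Y.1, X.2.inter Y.2⟩
  sup X Y := hull (X.1 ∪ Y.1)
  inf_le_left _ _ := Set.inter_subset_left
  inf_le_right _ _ := Set.inter_subset_right
  le_inf _ _ _ h h' := Set.subset_inter h h'
  le_sup_left _ _ := fun z hz => ⟨z, Or.inl hz, z, Or.inl hz, le_rfl, le_rfl⟩
  le_sup_right _ _ := fun z hz => ⟨z, Or.inr hz, z, Or.inr hz, le_rfl, le_rfl⟩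
  sup_le _ _ Z h h' := by
    rintro z ⟨x, hx, y, hy, hxz, hzy⟩
    exact Z.2.out (hx.elim (fun t => h t) (fun t => h' t))
      (hy.elim (fun t => h t) (fun t => h' t)) ⟨hxz, hzy⟩

instance : BoundedOrder (Co P) where
  bot := ⟨∅, Set.ordConnected_empty⟩
  bot_le _ := Set.empty_subset _
  top := ⟨Set.univ, Set.ordConnected_univ⟩
  le_top _ := Set.subset_univ _

end Co

/-! ### Lattice identities -/

/-- Lattice terms in the variables `var 0, var 1, …`. -/
inductive LatticeTerm : Type
  | var : ℕ → LatticeTerm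
  | meet : LatticeTerm → LatticeTerm → LatticeTerm
  | join : LatticeTerm → LatticeTerm → LatticeTerm

namespace LatticeTerm

instance : Min LatticeTerm := ⟨meet⟩
instance : Max LatticeTerm := ⟨join⟩

/-- The value of a term in a lattice. -/
def eval {L : Type u} [Lattice L] (v : ℕ → L) : LatticeTerm → L
  | var n => v n
  | meet s t => eval v s ⊓ eval v t
  | join s t => eval v s ⊔ eval v t

end LatticeTerm

/-- A lattice identity `lhs = rhs`. -/
structure LatticeIdentity : Type where
  lhs : LatticeTerm
  rhs : LatticeTerm

/-- The lattice `L` satisfies the identity `e`. -/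
def LatticeIdentity.Holds (e : LatticeIdentity) (L : Type u) [Lattice L] : Prop :=
  ∀ v : ℕ → L, e.lhs.eval v = e.rhs.eval v

namespace LatticeIdentity

open LatticeTerm

/-- The identity (HS) in the variables `a, b, c, b₀, b₁`, with `b' = b ∧ (b₀ ∨ b₁)`. -/
def HS : LatticeIdentity :=
  let a := var 0; let b := var 1; let c := var 2; let b₀ := var 3; let b₁ := var 4
  let b' := b ⊓ (b₀ ⊔ b₁)
  { lhs := a ⊓ (b' ⊔ c)
    rhs := (a ⊓ b')
      ⊔ ((a ⊓ ((b ⊓ b₀) ⊔ c)) ⊔ (a ⊓ ((b ⊓ b₁) ⊔ c)))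
      ⊔ ((a ⊓ ((b' ⊓ (a ⊔ b₀)) ⊔ c) ⊓ (b₀ ⊔ c) ⊓ (b ⊔ b₁))
        ⊔ (a ⊓ ((b' ⊓ (a ⊔ b₁)) ⊔ c) ⊓ (b₁ ⊔ c) ⊓ (b ⊔ b₀)))
      ⊔ ((a ⊓ ((b' ⊓ (a ⊔ b₀)) ⊔ c) ⊓ (b₀ ⊔ c) ⊓ (b₁ ⊔ c))
        ⊔ (a ⊓ ((b' ⊓ (a ⊔ b₁)) ⊔ c) ⊓ (b₀ ⊔ c) ⊓ (b₁ ⊔ c))) }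

/-- The identity (U) in the variables `x, x₀, x₁, x₂`. -/
def U : LatticeIdentity :=
  let x := var 0; let x₀ := var 1; let x₁ := var 2; let x₂ := var 3
  { lhs := x ⊓ (x₀ ⊔ x₁) ⊓ (x₀ ⊔ x₂) ⊓ (x₁ ⊔ x₂)
    rhs := (x ⊓ x₀ ⊓ (x₁ ⊔ x₂)) ⊔ (x ⊓ x₁ ⊓ (x₀ ⊔ x₂)) ⊔ (x ⊓ x₂ ⊓ (x₀ ⊔ x₁)) }

/-- The identity (B) in the variables `x, a₀, a₁, b₀, b₁`. -/
def B : LatticeIdentity :=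
  let x := var 0; let a₀ := var 1; let a₁ := var 2; let b₀ := var 3; let b₁ := var 4
  { lhs := x ⊓ (a₀ ⊔ a₁) ⊓ (b₀ ⊔ b₁)
    rhs := ((x ⊓ a₀ ⊓ (b₀ ⊔ b₁)) ⊔ (x ⊓ b₀ ⊓ (a₀ ⊔ a₁)))
      ⊔ ((x ⊓ a₁ ⊓ (b₀ ⊔ b₁)) ⊔ (x ⊓ b₁ ⊓ (a₀ ⊔ a₁)))
      ⊔ (x ⊓ (a₀ ⊔ a₁) ⊓ (b₀ ⊔ b₁) ⊓ (a₀ ⊔ b₀) ⊓ (a₁ ⊔ b₁))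
      ⊔ (x ⊓ (a₀ ⊔ a₁) ⊓ (b₀ ⊔ b₁) ⊓ (a₀ ⊔ b₁) ⊓ (a₁ ⊔ b₀)) }

/-- The identity (E) in the variables `x, a, b₀, b₁, b₂`. Here `s p q r` is the joinand of the
right-hand side that belongs to the permutation `σ` with
`(b_{σ(0)}, b_{σ(1)}, b_{σ(2)}) = (p, q, r)`. -/
def E : LatticeIdentity :=
  let x := var 0; let a := var 1; let b₀ := var 2; let b₁ := var 3; let b₂ := var 4
  let s : LatticeTerm → LatticeTerm → LatticeTerm → LatticeTerm := fun p q r =>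
    x ⊓ (a ⊔ (p ⊓ (x ⊔ q))) ⊓ (a ⊔ (q ⊓ (x ⊔ r) ⊓ (p ⊔ r))) ⊓ (a ⊔ r)
  { lhs := x ⊓ ((a ⊔ b₀) ⊓ (a ⊔ b₁) ⊓ (a ⊔ b₂))
    rhs := ((x ⊓ b₀ ⊓ ((a ⊔ b₁) ⊓ (a ⊔ b₂)))
        ⊔ (x ⊓ b₁ ⊓ ((a ⊔ b₀) ⊓ (a ⊔ b₂)))
        ⊔ (x ⊓ b₂ ⊓ ((a ⊔ b₀) ⊓ (a ⊔ b₁))))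
      ⊔ (s b₀ b₁ b₂ ⊔ s b₀ b₂ b₁ ⊔ s b₁ b₀ b₂ ⊔ s b₁ b₂ b₀ ⊔ s b₂ b₀ b₁ ⊔ s b₂ b₁ b₀) }

/-- The identity (P) in the variables `a, b, c, d, b₀, b₁`, with `b' = b ∧ (b₀ ∨ b₁)`. -/
def P : LatticeIdentity :=
  let a := var 0; let b := var 1; let c := var 2; let d := var 3
  let b₀ := var 4; let b₁ := var 5
  let b' := b ⊓ (b₀ ⊔ b₁)
  { lhs := a ⊓ (b' ⊔ c) ⊓ (c ⊔ d)
    rhs := (a ⊓ b' ⊓ (c ⊔ d)) ⊔ (a ⊓ d ⊓ (b' ⊔ c))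
      ⊔ (a ⊓ ((b' ⊓ (a ⊔ d)) ⊔ c) ⊓ (c ⊔ d))
      ⊔ ((a ⊓ (b₀ ⊔ c) ⊓ ((b' ⊓ (a ⊔ b₀) ⊓ (b₀ ⊔ d)) ⊔ c) ⊓ (c ⊔ d))
        ⊔ (a ⊓ (b₁ ⊔ c) ⊓ ((b' ⊓ (a ⊔ b₁) ⊓ (b₁ ⊔ d)) ⊔ c) ⊓ (c ⊔ d))) }

end LatticeIdentity

/-- A class of lattices is a finitely based variety if it consists of all lattices that satisfy
a certain finite set of identities. -/
def IsFinitelyBasedVariety (K : (L : Type u) → [Lattice L] → Prop) : Prop :=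
  ∃ S : Set LatticeIdentity, S.Finite ∧
    ∀ (L : Type u) [Lattice L], K L ↔ ∀ e ∈ S, e.Holds L

/-! ### Lattice-theoretical notions -/

/-- The lattice `L` embeds into a product of lattices of convex subsets of chains. -/
def SUBLO (L : Type u) [Lattice L] : Prop :=
  ∃ (I : Type u) (T : I → Type u) (_ : ∀ i, LinearOrder (T i))
    (φ : LatticeHom L (∀ i, Co (T i))), Function.Injective φ

/-- An atom: an element that covers the least element of the lattice (if there is no least
element, then there are no atoms). -/
def IsLatticeAtom {L : Type u} [Lattice L] (a : L) : Prop :=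
  ∃ z : L, IsBot z ∧ z ⋖ a

/-- Every element is a join of atoms. -/
def AtomisticLattice (L : Type u) [Lattice L] : Prop :=
  ∀ x : L, ∃ S : Set L, (∀ a ∈ S, IsLatticeAtom a) ∧ IsLUB S x

/-- A lattice is subdirectly irreducible if it has a smallest nonzero congruence, where a
congruence is nonzero if it identifies two distinct elements. -/
def SubdirectlyIrreducible (L : Type u) [Lattice L] : Prop :=
  ∃ μ : LatticeCon L, (∃ x y : L, μ.r x y ∧ x ≠ y) ∧
    ∀ θ : LatticeCon L, (∃ x y : L, θ.r x y ∧ x ≠ y) → ∀ x y : L, μ.r x y → θ.r x y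

/-- The set `J(L)` of all join-irreducible elements of `L` (the least element is excluded). -/
abbrev JoinIrr (L : Type u) [Lattice L] : Type u := {a : L // SupIrred a}

/-! In `Co T` with `T` a chain, a point `z` lies in a join exactly when it lies in one of the two
sets or between a point of each. So every identity becomes a finite statement about the relative
positions of points on a line, which proves that the identities are necessary.

Conversely, the identities are read at a join-irreducible `p`. All joinands of the right-hand sides
lie below `p`, so join-irreducibility selects one of them, and each identity becomes a dichotomy
about the minimal nontrivial covers `p ≤ u ⊔ v`. (U) and (B) split the elements of such covers into
two sides of `p`: two of them join above `p` exactly when their sides differ. (E) makes the relation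
`q ≤ p ⊔ r`, "q is at least as near to `p` as `r`", a total preorder on each side, with nearer and
farther elements joining above those in between; (HS) makes it antisymmetric. One side, then `p`,
then the other side form a chain, `DepChain p`. (HS) and (P) show in `MinCover.hereditary` that
minimal covers of members of the chain consist of members of the chain, correctly placed. Hence `x ↦
{q | q ≤ x}` is a homomorphism to `Co (DepChain p)`, and letting `p` vary separates the elements.

This needs enough join-irreducibles and enough minimal covers. Finite lattices have both; any other
lattice is first embedded in its filter lattice, which satisfies the same identities and has both by
Zorn's lemma. If the lattice is subdirectly irreducible, one `p` already gives an embedding, and in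
the finite case its chain must contain every join-irreducible. The class is therefore defined by the
five identities, hence closed under homomorphic images. -/

namespace LatticeIdentity

/-! ### The identities as one-sided inequalities -/

open LatticeTerm

variable {L : Type u} [Lattice L]

/-- In this identity, as in the next four, every joinand on the right is below the left-hand side in
any lattice, so only one inequality carries content. -/
theorem holds_HS_iff : HS.Holds L ↔ ∀ a b c b₀ b₁ : L,
    a ⊓ (b ⊓ (b₀ ⊔ b₁) ⊔ c) ≤ (a ⊓ (b ⊓ (b₀ ⊔ b₁)))
      ⊔ ((a ⊓ ((b ⊓ b₀) ⊔ c)) ⊔ (a ⊓ ((b ⊓ b₁) ⊔ c)))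
      ⊔ ((a ⊓ ((b ⊓ (b₀ ⊔ b₁) ⊓ (a ⊔ b₀)) ⊔ c) ⊓ (b₀ ⊔ c) ⊓ (b ⊔ b₁))
        ⊔ (a ⊓ ((b ⊓ (b₀ ⊔ b₁) ⊓ (a ⊔ b₁)) ⊔ c) ⊓ (b₁ ⊔ c) ⊓ (b ⊔ b₀)))
      ⊔ ((a ⊓ ((b ⊓ (b₀ ⊔ b₁) ⊓ (a ⊔ b₀)) ⊔ c) ⊓ (b₀ ⊔ c) ⊓ (b₁ ⊔ c))
        ⊔ (a ⊓ ((b ⊓ (b₀ ⊔ b₁) ⊓ (a ⊔ b₁)) ⊔ c) ⊓ (b₀ ⊔ c) ⊓ (b₁ ⊔ c))) := by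
  refine ⟨fun h a b c b₀ b₁ => (h fun n => match n with
    | 0 => a | 1 => b | 2 => c | 3 => b₀ | _ => b₁).le, fun h v => le_antisymm (h _ _ _ _ _) ?_⟩
  change _ ≤ v 0 ⊓ (v 1 ⊓ (v 3 ⊔ v 4) ⊔ v 2)
  have key : ∀ x : L, x ≤ v 1 ⊓ (v 3 ⊔ v 4) →
      v 0 ⊓ (x ⊔ v 2) ≤ v 0 ⊓ (v 1 ⊓ (v 3 ⊔ v 4) ⊔ v 2) := fun x hx =>
    inf_le_inf_left _ (sup_le_sup_right hx _)
  have key₂ : ∀ x y z : L, x ≤ v 1 ⊓ (v 3 ⊔ v 4) →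
      v 0 ⊓ (x ⊔ v 2) ⊓ y ⊓ z ≤ v 0 ⊓ (v 1 ⊓ (v 3 ⊔ v 4) ⊔ v 2) := fun x y z hx =>
    inf_le_left.trans (inf_le_left.trans (key x hx))
  exact sup_le (sup_le (sup_le (inf_le_inf_left _ le_sup_left)
    (sup_le (key _ (inf_le_inf_left _ le_sup_left)) (key _ (inf_le_inf_left _ le_sup_right))))
    (sup_le (key₂ _ _ _ inf_le_left) (key₂ _ _ _ inf_le_left)))
    (sup_le (key₂ _ _ _ inf_le_left) (key₂ _ _ _ inf_le_left))

theorem holds_U_iff : U.Holds L ↔ ∀ x x₀ x₁ x₂ : L,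
    x ⊓ (x₀ ⊔ x₁) ⊓ (x₀ ⊔ x₂) ⊓ (x₁ ⊔ x₂) ≤
      (x ⊓ x₀ ⊓ (x₁ ⊔ x₂)) ⊔ (x ⊓ x₁ ⊓ (x₀ ⊔ x₂)) ⊔ (x ⊓ x₂ ⊓ (x₀ ⊔ x₁)) := by
  refine ⟨fun h x x₀ x₁ x₂ => (h fun n => match n with
    | 0 => x | 1 => x₀ | 2 => x₁ | _ => x₂).le, fun h v => le_antisymm (h _ _ _ _) ?_⟩
  change (v 0 ⊓ v 1 ⊓ (v 2 ⊔ v 3)) ⊔ (v 0 ⊓ v 2 ⊓ (v 1 ⊔ v 3)) ⊔ (v 0 ⊓ v 3 ⊓ (v 1 ⊔ v 2)) ≤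
    v 0 ⊓ (v 1 ⊔ v 2) ⊓ (v 1 ⊔ v 3) ⊓ (v 2 ⊔ v 3)
  have h₁ : ∀ {x y z : L}, x ⊓ y ⊓ z ≤ x := inf_le_left.trans inf_le_left
  have h₂ : ∀ {x y z w : L}, x ⊓ y ⊓ z ≤ y ⊔ w :=
    (inf_le_left.trans inf_le_right).trans le_sup_left
  have h₃ : ∀ {x y z w : L}, x ⊓ y ⊓ z ≤ w ⊔ y :=
    (inf_le_left.trans inf_le_right).trans le_sup_right
  exact sup_le (sup_le (le_inf (le_inf (le_inf h₁ h₂) h₂) inf_le_right)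
    (le_inf (le_inf (le_inf h₁ h₃) inf_le_right) h₂))
    (le_inf (le_inf (le_inf h₁ inf_le_right) h₃) h₃)

theorem holds_B_iff : B.Holds L ↔ ∀ x a₀ a₁ b₀ b₁ : L,
    x ⊓ (a₀ ⊔ a₁) ⊓ (b₀ ⊔ b₁) ≤
      ((x ⊓ a₀ ⊓ (b₀ ⊔ b₁)) ⊔ (x ⊓ b₀ ⊓ (a₀ ⊔ a₁)))
      ⊔ ((x ⊓ a₁ ⊓ (b₀ ⊔ b₁)) ⊔ (x ⊓ b₁ ⊓ (a₀ ⊔ a₁)))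
      ⊔ (x ⊓ (a₀ ⊔ a₁) ⊓ (b₀ ⊔ b₁) ⊓ (a₀ ⊔ b₀) ⊓ (a₁ ⊔ b₁))
      ⊔ (x ⊓ (a₀ ⊔ a₁) ⊓ (b₀ ⊔ b₁) ⊓ (a₀ ⊔ b₁) ⊓ (a₁ ⊔ b₀)) := by
  refine ⟨fun h x a₀ a₁ b₀ b₁ => (h fun n => match n with
    | 0 => x | 1 => a₀ | 2 => a₁ | 3 => b₀ | _ => b₁).le, fun h v => le_antisymm (h _ _ _ _ _) ?_⟩
  change ((v 0 ⊓ v 1 ⊓ (v 3 ⊔ v 4)) ⊔ (v 0 ⊓ v 3 ⊓ (v 1 ⊔ v 2)))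
    ⊔ ((v 0 ⊓ v 2 ⊓ (v 3 ⊔ v 4)) ⊔ (v 0 ⊓ v 4 ⊓ (v 1 ⊔ v 2)))
    ⊔ (v 0 ⊓ (v 1 ⊔ v 2) ⊓ (v 3 ⊔ v 4) ⊓ _ ⊓ _)
    ⊔ (v 0 ⊓ (v 1 ⊔ v 2) ⊓ (v 3 ⊔ v 4) ⊓ _ ⊓ _) ≤ v 0 ⊓ (v 1 ⊔ v 2) ⊓ (v 3 ⊔ v 4)
  refine sup_le (sup_le (sup_le (sup_le ?_ ?_) (sup_le ?_ ?_)) (inf_le_left.trans inf_le_left))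
    (inf_le_left.trans inf_le_left)
  · exact inf_le_inf_right _ (inf_le_inf_left _ le_sup_left)
  · rw [inf_right_comm]
    exact inf_le_inf_left _ le_sup_left
  · exact inf_le_inf_right _ (inf_le_inf_left _ le_sup_right)
  · rw [inf_right_comm]
    exact inf_le_inf_left _ le_sup_right

theorem holds_E_iff : E.Holds L ↔ ∀ x a b₀ b₁ b₂ : L,
    x ⊓ ((a ⊔ b₀) ⊓ (a ⊔ b₁) ⊓ (a ⊔ b₂)) ≤
      ((x ⊓ b₀ ⊓ ((a ⊔ b₁) ⊓ (a ⊔ b₂)))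
        ⊔ (x ⊓ b₁ ⊓ ((a ⊔ b₀) ⊓ (a ⊔ b₂)))
        ⊔ (x ⊓ b₂ ⊓ ((a ⊔ b₀) ⊓ (a ⊔ b₁))))
      ⊔ ((x ⊓ (a ⊔ (b₀ ⊓ (x ⊔ b₁))) ⊓ (a ⊔ (b₁ ⊓ (x ⊔ b₂) ⊓ (b₀ ⊔ b₂))) ⊓ (a ⊔ b₂))
        ⊔ (x ⊓ (a ⊔ (b₀ ⊓ (x ⊔ b₂))) ⊓ (a ⊔ (b₂ ⊓ (x ⊔ b₁) ⊓ (b₀ ⊔ b₁))) ⊓ (a ⊔ b₁))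
        ⊔ (x ⊓ (a ⊔ (b₁ ⊓ (x ⊔ b₀))) ⊓ (a ⊔ (b₀ ⊓ (x ⊔ b₂) ⊓ (b₁ ⊔ b₂))) ⊓ (a ⊔ b₂))
        ⊔ (x ⊓ (a ⊔ (b₁ ⊓ (x ⊔ b₂))) ⊓ (a ⊔ (b₂ ⊓ (x ⊔ b₀) ⊓ (b₁ ⊔ b₀))) ⊓ (a ⊔ b₀))
        ⊔ (x ⊓ (a ⊔ (b₂ ⊓ (x ⊔ b₀))) ⊓ (a ⊔ (b₀ ⊓ (x ⊔ b₁) ⊓ (b₂ ⊔ b₁))) ⊓ (a ⊔ b₁))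
        ⊔ (x ⊓ (a ⊔ (b₂ ⊓ (x ⊔ b₁))) ⊓ (a ⊔ (b₁ ⊓ (x ⊔ b₀) ⊓ (b₂ ⊔ b₀))) ⊓ (a ⊔ b₀))) := by
  refine ⟨fun h x a b₀ b₁ b₂ => (h fun n => match n with
    | 0 => x | 1 => a | 2 => b₀ | 3 => b₁ | _ => b₂).le, fun h v => le_antisymm (h _ _ _ _ _) ?_⟩
  have key : ∀ x a p q r s t w : L, x ⊓ (a ⊔ p ⊓ s) ⊓ (a ⊔ q ⊓ t ⊓ w) ⊓ (a ⊔ r) ≤ x ∧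
      x ⊓ (a ⊔ p ⊓ s) ⊓ (a ⊔ q ⊓ t ⊓ w) ⊓ (a ⊔ r) ≤ a ⊔ p ∧
      x ⊓ (a ⊔ p ⊓ s) ⊓ (a ⊔ q ⊓ t ⊓ w) ⊓ (a ⊔ r) ≤ a ⊔ q ∧
      x ⊓ (a ⊔ p ⊓ s) ⊓ (a ⊔ q ⊓ t ⊓ w) ⊓ (a ⊔ r) ≤ a ⊔ r := fun x a p q r s t w =>
    ⟨inf_le_left.trans (inf_le_left.trans inf_le_left),
      inf_le_left.trans (inf_le_left.trans (inf_le_right.trans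
        (sup_le_sup_left inf_le_left _))),
      inf_le_left.trans (inf_le_right.trans
        (sup_le_sup_left (inf_le_left.trans inf_le_left) _)), inf_le_right⟩
  have key₂ : ∀ x a p q r : L, x ⊓ p ⊓ ((a ⊔ q) ⊓ (a ⊔ r)) ≤ x ∧
      x ⊓ p ⊓ ((a ⊔ q) ⊓ (a ⊔ r)) ≤ a ⊔ p ∧ x ⊓ p ⊓ ((a ⊔ q) ⊓ (a ⊔ r)) ≤ a ⊔ q ∧
      x ⊓ p ⊓ ((a ⊔ q) ⊓ (a ⊔ r)) ≤ a ⊔ r := fun x a p q r =>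
    ⟨inf_le_left.trans inf_le_left, inf_le_left.trans (inf_le_right.trans le_sup_right),
      inf_le_right.trans inf_le_left, inf_le_right.trans inf_le_right⟩
  have glue : ∀ {m x y z w : L}, m ≤ x → m ≤ y → m ≤ z → m ≤ w → m ≤ x ⊓ (y ⊓ z ⊓ w) :=
    fun h₁ h₂ h₃ h₄ => le_inf h₁ (le_inf (le_inf h₂ h₃) h₄)
  refine sup_le (sup_le (sup_le ?_ ?_) ?_)
    (sup_le (sup_le (sup_le (sup_le (sup_le ?_ ?_) ?_) ?_) ?_) ?_)
  · obtain ⟨h₁, h₂, h₃, h₄⟩ := key₂ (v 0) (v 1) (v 2) (v 3) (v 4)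
    exact glue h₁ h₂ h₃ h₄
  · obtain ⟨h₁, h₂, h₃, h₄⟩ := key₂ (v 0) (v 1) (v 3) (v 2) (v 4)
    exact glue h₁ h₃ h₂ h₄
  · obtain ⟨h₁, h₂, h₃, h₄⟩ := key₂ (v 0) (v 1) (v 4) (v 2) (v 3)
    exact glue h₁ h₃ h₄ h₂
  · obtain ⟨h₁, h₂, h₃, h₄⟩ := key (v 0) (v 1) (v 2) (v 3) (v 4) _ _ _
    exact glue h₁ h₂ h₃ h₄
  · obtain ⟨h₁, h₂, h₃, h₄⟩ := key (v 0) (v 1) (v 2) (v 4) (v 3) _ _ _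
    exact glue h₁ h₂ h₄ h₃
  · obtain ⟨h₁, h₂, h₃, h₄⟩ := key (v 0) (v 1) (v 3) (v 2) (v 4) _ _ _
    exact glue h₁ h₃ h₂ h₄
  · obtain ⟨h₁, h₂, h₃, h₄⟩ := key (v 0) (v 1) (v 3) (v 4) (v 2) _ _ _
    exact glue h₁ h₄ h₂ h₃
  · obtain ⟨h₁, h₂, h₃, h₄⟩ := key (v 0) (v 1) (v 4) (v 2) (v 3) _ _ _
    exact glue h₁ h₃ h₄ h₂
  · obtain ⟨h₁, h₂, h₃, h₄⟩ := key (v 0) (v 1) (v 4) (v 3) (v 2) _ _ _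
    exact glue h₁ h₄ h₃ h₂

theorem holds_P_iff : P.Holds L ↔ ∀ a b c d b₀ b₁ : L,
    a ⊓ (b ⊓ (b₀ ⊔ b₁) ⊔ c) ⊓ (c ⊔ d) ≤
      (a ⊓ (b ⊓ (b₀ ⊔ b₁)) ⊓ (c ⊔ d)) ⊔ (a ⊓ d ⊓ (b ⊓ (b₀ ⊔ b₁) ⊔ c))
      ⊔ (a ⊓ ((b ⊓ (b₀ ⊔ b₁) ⊓ (a ⊔ d)) ⊔ c) ⊓ (c ⊔ d))
      ⊔ ((a ⊓ (b₀ ⊔ c) ⊓ ((b ⊓ (b₀ ⊔ b₁) ⊓ (a ⊔ b₀) ⊓ (b₀ ⊔ d)) ⊔ c) ⊓ (c ⊔ d))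
        ⊔ (a ⊓ (b₁ ⊔ c) ⊓ ((b ⊓ (b₀ ⊔ b₁) ⊓ (a ⊔ b₁) ⊓ (b₁ ⊔ d)) ⊔ c) ⊓ (c ⊔ d))) := by
  refine ⟨fun h a b c d b₀ b₁ => (h fun n => match n with
    | 0 => a | 1 => b | 2 => c | 3 => d | 4 => b₀ | _ => b₁).le,
    fun h v => le_antisymm (h _ _ _ _ _ _) ?_⟩
  refine sup_le (sup_le (sup_le ?_ ?_) ?_) (sup_le ?_ ?_)
  · exact inf_le_inf_right _ (inf_le_inf_left _ le_sup_left)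
  · exact le_inf (inf_le_inf_right _ inf_le_left)
      (inf_le_left.trans (inf_le_right.trans le_sup_right))
  · exact inf_le_inf_right _ (inf_le_inf_left _ (sup_le_sup_right inf_le_left _))
  · exact inf_le_inf_right _ (inf_le_inf inf_le_left
      (sup_le_sup_right (inf_le_left.trans inf_le_left) _))
  · exact inf_le_inf_right _ (inf_le_inf inf_le_left
      (sup_le_sup_right (inf_le_left.trans inf_le_left) _))

end LatticeIdentity

/-! ### The five identities hold for convex subsets of a chain -/

namespace Co

variable {T : Type u} [LinearOrder T]

theorem le_def {X Y : Co T} : X ≤ Y ↔ ∀ z ∈ X.1, z ∈ Y.1 := Iff.rfl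

theorem mem_sup_left {X Y : Co T} {z : T} (h : z ∈ X.1) : z ∈ (X ⊔ Y).1 :=
  le_def.1 (le_sup_left : X ≤ X ⊔ Y) z h

theorem mem_sup_right {X Y : Co T} {z : T} (h : z ∈ Y.1) : z ∈ (X ⊔ Y).1 :=
  le_def.1 (le_sup_right : Y ≤ X ⊔ Y) z h

theorem mem_of_between {X : Co T} {x y z : T} (hx : x ∈ X.1) (hy : y ∈ X.1)
    (h : (x ≤ z ∧ z ≤ y) ∨ (y ≤ z ∧ z ≤ x)) : z ∈ X.1 :=
  h.elim (fun h => X.2.out hx hy h) fun h => X.2.out hy hx h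

theorem mem_sup_of_between {X Y : Co T} {x y z : T} (hx : x ∈ X.1) (hy : y ∈ Y.1)
    (h : (x ≤ z ∧ z ≤ y) ∨ (y ≤ z ∧ z ≤ x)) : z ∈ (X ⊔ Y).1 :=
  mem_of_between (mem_sup_left hx) (mem_sup_right hy) h

theorem mem_sup {X Y : Co T} {z : T} : z ∈ (X ⊔ Y).1 ↔ z ∈ X.1 ∨ z ∈ Y.1 ∨
    ∃ x ∈ X.1, ∃ y ∈ Y.1, (x ≤ z ∧ z ≤ y) ∨ (y ≤ z ∧ z ≤ x) := by
  constructor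
  · rintro ⟨x, hx | hx, y, hy | hy, h⟩
    · exact Or.inl (mem_of_between hx hy (Or.inl h))
    · exact Or.inr (Or.inr ⟨x, hx, y, hy, Or.inl h⟩)
    · exact Or.inr (Or.inr ⟨y, hy, x, hx, Or.inr h⟩)
    · exact Or.inr (Or.inl (mem_of_between hx hy (Or.inl h)))
  · rintro (h | h | ⟨x, hx, y, hy, h⟩)
    · exact mem_sup_left h
    · exact mem_sup_right h
    · exact mem_sup_of_between hx hy h

open LatticeIdentity

theorem holds_U : U.Holds (Co T) := by
  refine holds_U_iff.2 fun x x₀ x₁ x₂ z ⟨⟨⟨hx, h₀₁⟩, h₀₂⟩, h₁₂⟩ => ?_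
  by_cases h₀ : z ∈ x₀.1
  · exact mem_sup_left (mem_sup_left ⟨⟨hx, h₀⟩, h₁₂⟩)
  by_cases h₁ : z ∈ x₁.1
  · exact mem_sup_left (mem_sup_right ⟨⟨hx, h₁⟩, h₀₂⟩)
  by_cases h₂ : z ∈ x₂.1
  · exact mem_sup_right ⟨⟨hx, h₂⟩, h₀₁⟩
  exfalso
  obtain h | h | ⟨p, hp, q, hq, hpq⟩ := mem_sup.1 h₀₁
  · exact h₀ h
  · exact h₁ h
  obtain h | h | ⟨p', hp', r, hr, hpr⟩ := mem_sup.1 h₀₂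
  · exact h₀ h
  · exact h₂ h
  obtain h | h | ⟨q', hq', r', hr', hqr⟩ := mem_sup.1 h₁₂
  · exact h₁ h
  · exact h₂ h
  -- No `xᵢ` contains `z`, so by convexity each lies on one side of `z`. Two of the three share a
  -- side, yet `z` is between any two of them.
  have hP := fun h => h₀ (mem_of_between hp hp' h)
  have hQ := fun h => h₁ (mem_of_between hq hq' h)
  have hR := fun h => h₂ (mem_of_between hr hr' h)
  grind

theorem holds_B : B.Holds (Co T) := by
  refine holds_B_iff.2 fun x a₀ a₁ b₀ b₁ z ⟨⟨hx, ha⟩, hb⟩ => ?_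
  obtain h | h | ⟨p, hp, q, hq, hpq⟩ := mem_sup.1 ha
  · exact mem_sup_left (mem_sup_left (mem_sup_left (mem_sup_left ⟨⟨hx, h⟩, hb⟩)))
  · exact mem_sup_left (mem_sup_left (mem_sup_right (mem_sup_left ⟨⟨hx, h⟩, hb⟩)))
  obtain h | h | ⟨r, hr, s, hs, hrs⟩ := mem_sup.1 hb
  · exact mem_sup_left (mem_sup_left (mem_sup_left (mem_sup_right ⟨⟨hx, h⟩, ha⟩)))
  · exact mem_sup_left (mem_sup_left (mem_sup_right (mem_sup_right ⟨⟨hx, h⟩, ha⟩)))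
  -- `p`, `q` are on opposite sides of `z`, and so are `r`, `s`; hence `p` is opposite to `r` or to
  -- `s`, and `q` to the other one.
  by_cases h : (p ≤ z ∧ z ≤ r) ∨ (r ≤ z ∧ z ≤ p)
  · by_cases h' : (q ≤ z ∧ z ≤ s) ∨ (s ≤ z ∧ z ≤ q)
    · exact mem_sup_left (mem_sup_right ⟨⟨⟨⟨hx, ha⟩, hb⟩, mem_sup_of_between hp hr h⟩,
        mem_sup_of_between hq hs h'⟩)
    · exact mem_sup_right ⟨⟨⟨⟨hx, ha⟩, hb⟩, mem_sup_of_between hp hs (by grind)⟩,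
        mem_sup_of_between hq hr (by grind)⟩
  · exact mem_sup_right ⟨⟨⟨⟨hx, ha⟩, hb⟩, mem_sup_of_between hp hs (by grind)⟩,
        mem_sup_of_between hq hr (by grind)⟩

theorem holds_HS : HS.Holds (Co T) := by
  refine holds_HS_iff.2 fun a b c b₀ b₁ z ⟨ha, h⟩ => ?_
  obtain h | h | ⟨y, hy, w, hw, hyw⟩ := mem_sup.1 h
  · exact mem_sup_left (mem_sup_left (mem_sup_left ⟨ha, h⟩))
  · exact mem_sup_left (mem_sup_left (mem_sup_right (mem_sup_left ⟨ha, mem_sup_right h⟩)))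
  obtain ⟨hyb, hy'⟩ := id hy
  by_cases hyz : y = z
  · exact mem_sup_left (mem_sup_left (mem_sup_left ⟨ha, hyz ▸ hy⟩))
  obtain h | h | ⟨y₀, hy₀, y₁, hy₁, h₀₁⟩ := mem_sup.1 hy'
  · exact mem_sup_left (mem_sup_left (mem_sup_right (mem_sup_left
      ⟨ha, mem_sup_of_between (X := b ⊓ b₀) ⟨hyb, h⟩ hw hyw⟩)))
  · exact mem_sup_left (mem_sup_left (mem_sup_right (mem_sup_right
      ⟨ha, mem_sup_of_between (X := b ⊓ b₁) ⟨hyb, h⟩ hw hyw⟩)))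
  -- Of the two points around `y`, `t` is the one beyond `y` as seen from `z`. The other, `t'`, is
  -- either across `z` from `y`, or on the same side of `z` as `y` and hence across from `w`.
  have key : ∀ {B B' : Co T} {t t' : T}, t ∈ B.1 → t' ∈ B'.1 →
      ((z ≤ y ∧ y ≤ t ∧ t' ≤ y) ∨ (t ≤ y ∧ y ≤ z ∧ y ≤ t')) →
      z ∈ (a ⊓ (b ⊓ (b₀ ⊔ b₁) ⊓ (a ⊔ B) ⊔ c) ⊓ (B ⊔ c)).1 ∧ (z ∈ (b ⊔ B').1 ∨ z ∈ (B' ⊔ c).1) := by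
    intro B B' t t' ht ht' h
    refine ⟨⟨⟨ha, mem_sup_of_between (y := w) (x := y) ⟨hy, mem_sup_of_between ha ht ?_⟩ hw hyw⟩,
      mem_sup_of_between ht hw ?_⟩, ?_⟩
    · grind
    · grind
    · by_cases h' : (y ≤ z ∧ z ≤ t') ∨ (t' ≤ z ∧ z ≤ y)
      · exact Or.inl (mem_sup_of_between hyb ht' h')
      · exact Or.inr (mem_sup_of_between ht' hw (by grind))
  by_cases h : (z ≤ y ∧ y ≤ y₀ ∧ y₁ ≤ y) ∨ (y₀ ≤ y ∧ y ≤ z ∧ y ≤ y₁)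
  · obtain ⟨h₁, h₂ | h₂⟩ := key hy₀ hy₁ h
    · exact mem_sup_left (mem_sup_right (mem_sup_left ⟨h₁, h₂⟩))
    · exact mem_sup_right (mem_sup_left ⟨h₁, h₂⟩)
  · obtain ⟨h₁, h₂ | h₂⟩ := key hy₁ hy₀ (by grind)
    · exact mem_sup_left (mem_sup_right (mem_sup_right ⟨h₁, h₂⟩))
    · exact mem_sup_right (mem_sup_right ⟨⟨h₁.1, h₂⟩, h₁.2⟩)

theorem holds_P : P.Holds (Co T) := by
  refine holds_P_iff.2 fun a b c d b₀ b₁ z ⟨⟨ha, hbc⟩, hcd⟩ => ?_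
  obtain h | h | ⟨y, hy, w, hw, hyw⟩ := mem_sup.1 hbc
  · exact mem_sup_left (mem_sup_left (mem_sup_left ⟨⟨ha, h⟩, hcd⟩))
  · exact mem_sup_left (mem_sup_right ⟨⟨ha, mem_sup_right h⟩, hcd⟩)
  obtain h | h | ⟨w', hw', δ, hδ, hδw⟩ := mem_sup.1 hcd
  · exact mem_sup_left (mem_sup_right ⟨⟨ha, mem_sup_right h⟩, hcd⟩)
  · exact mem_sup_left (mem_sup_left (mem_sup_right ⟨⟨ha, h⟩, hbc⟩))
  by_cases hc : z ∈ c.1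
  · exact mem_sup_left (mem_sup_right ⟨⟨ha, mem_sup_right hc⟩, hcd⟩)
  -- As `z ∉ c`, the points `w` and `w'` are on one side of `z`, so `y` and `δ` are both on the
  -- other. The question is then which of these two is nearer to `z`.
  have hww := fun h => hc (mem_of_between hw hw' h)
  by_cases hyδ : (z ≤ y ∧ y ≤ δ) ∨ (δ ≤ y ∧ y ≤ z)
  · exact mem_sup_left (mem_sup_right ⟨⟨ha, mem_sup_of_between (x := y) (y := w)
      ⟨hy, mem_sup_of_between ha hδ (by grind)⟩ hw hyw⟩, hcd⟩)
  -- Now `δ` lies between `z` and `y`, so a point `t` beyond `y` has `y` between itself and `δ`.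
  have key : ∀ {B : Co T} {t : T}, t ∈ B.1 → ((z ≤ y ∧ y ≤ t) ∨ (t ≤ y ∧ y ≤ z)) →
      z ∈ (a ⊓ (B ⊔ c) ⊓ (b ⊓ (b₀ ⊔ b₁) ⊓ (a ⊔ B) ⊓ (B ⊔ d) ⊔ c) ⊓ (c ⊔ d)).1 := by
    intro B t ht h
    refine ⟨⟨⟨ha, mem_sup_of_between ht hw ?_⟩, mem_sup_of_between (x := y) (y := w)
      ⟨⟨hy, mem_sup_of_between ha ht ?_⟩, mem_sup_of_between ht hδ ?_⟩ hw hyw⟩, hcd⟩ <;> grind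
  obtain h | h | ⟨y₀, hy₀, y₁, hy₁, h₀₁⟩ := mem_sup.1 hy.2
  · exact mem_sup_right (mem_sup_left (key h (by grind)))
  · exact mem_sup_right (mem_sup_right (key h (by grind)))
  by_cases h : (z ≤ y ∧ y ≤ y₀) ∨ (y₀ ≤ y ∧ y ≤ z)
  · exact mem_sup_right (mem_sup_left (key hy₀ h))
  · exact mem_sup_right (mem_sup_right (key hy₁ (by grind)))

theorem holds_E : E.Holds (Co T) := by
  refine holds_E_iff.2 fun x a b₀ b₁ b₂ z ⟨hx, ⟨h₀, h₁⟩, h₂⟩ => ?_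
  by_cases ha : z ∈ a.1
  · exact mem_sup_right (mem_sup_left (mem_sup_left (mem_sup_left (mem_sup_left (mem_sup_left
      ⟨⟨⟨hx, mem_sup_left ha⟩, mem_sup_left ha⟩, mem_sup_left ha⟩)))))
  obtain h | h | ⟨u₀, hu₀, t₀, ht₀, h₀'⟩ := mem_sup.1 h₀
  · exact absurd h ha
  · exact mem_sup_left (mem_sup_left (mem_sup_left ⟨⟨hx, h⟩, h₁, h₂⟩))
  obtain h | h | ⟨u₁, hu₁, t₁, ht₁, h₁'⟩ := mem_sup.1 h₁
  · exact absurd h ha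
  · exact mem_sup_left (mem_sup_left (mem_sup_right ⟨⟨hx, h⟩, h₀, h₂⟩))
  obtain h | h | ⟨u₂, hu₂, t₂, ht₂, h₂'⟩ := mem_sup.1 h₂
  · exact absurd h ha
  · exact mem_sup_left (mem_sup_right ⟨⟨hx, h⟩, h₀, h₁⟩)
  have h₀₁ := fun h => ha (mem_of_between hu₀ hu₁ h)
  have h₁₂ := fun h => ha (mem_of_between hu₁ hu₂ h)
  have h₀₂ := fun h => ha (mem_of_between hu₀ hu₂ h)
  -- All `uᵢ` are on one side of `z` and all `tᵢ` on the other. Each of the six ways to sort the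
  -- `tᵢ` by distance from `z` gives the joinand of one permutation.
  have key : ∀ {A B C : Co T} {u v p q r : T}, u ∈ a.1 → v ∈ a.1 → p ∈ A.1 → q ∈ B.1 → r ∈ C.1 →
      ((u ≤ z ∧ z ≤ p) ∨ (p ≤ z ∧ z ≤ u)) → ((v ≤ z ∧ z ≤ q) ∨ (q ≤ z ∧ z ≤ v)) →
      ((z ≤ p ∧ p ≤ q ∧ q ≤ r) ∨ (r ≤ q ∧ q ≤ p ∧ p ≤ z)) → z ∈ (a ⊔ C).1 →
      z ∈ (x ⊓ (a ⊔ A ⊓ (x ⊔ B)) ⊓ (a ⊔ B ⊓ (x ⊔ C) ⊓ (A ⊔ C)) ⊓ (a ⊔ C)).1 := by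
    intro A B C u v p q r hu hv hp hq hr h h' h'' hz
    exact ⟨⟨⟨hx, mem_sup_of_between hu (y := p) ⟨hp, mem_sup_of_between hx hq (by grind)⟩ h⟩,
      mem_sup_of_between hv (y := q) ⟨⟨hq, mem_sup_of_between hx hr (by grind)⟩,
        mem_sup_of_between hp hr (by grind)⟩ h'⟩, hz⟩
  by_cases c₁ : (z ≤ t₀ ∧ t₀ ≤ t₁ ∧ t₁ ≤ t₂) ∨ (t₂ ≤ t₁ ∧ t₁ ≤ t₀ ∧ t₀ ≤ z)
  · exact mem_sup_right (mem_sup_left (mem_sup_left (mem_sup_left (mem_sup_left (mem_sup_left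
      (key hu₀ hu₁ ht₀ ht₁ ht₂ h₀' h₁' c₁ h₂))))))
  by_cases c₂ : (z ≤ t₀ ∧ t₀ ≤ t₂ ∧ t₂ ≤ t₁) ∨ (t₁ ≤ t₂ ∧ t₂ ≤ t₀ ∧ t₀ ≤ z)
  · exact mem_sup_right (mem_sup_left (mem_sup_left (mem_sup_left (mem_sup_left (mem_sup_right
      (key hu₀ hu₂ ht₀ ht₂ ht₁ h₀' h₂' c₂ h₁))))))
  by_cases c₃ : (z ≤ t₁ ∧ t₁ ≤ t₀ ∧ t₀ ≤ t₂) ∨ (t₂ ≤ t₀ ∧ t₀ ≤ t₁ ∧ t₁ ≤ z)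
  · exact mem_sup_right (mem_sup_left (mem_sup_left (mem_sup_left (mem_sup_right
      (key hu₁ hu₀ ht₁ ht₀ ht₂ h₁' h₀' c₃ h₂)))))
  by_cases c₄ : (z ≤ t₁ ∧ t₁ ≤ t₂ ∧ t₂ ≤ t₀) ∨ (t₀ ≤ t₂ ∧ t₂ ≤ t₁ ∧ t₁ ≤ z)
  · exact mem_sup_right (mem_sup_left (mem_sup_left (mem_sup_right
      (key hu₁ hu₂ ht₁ ht₂ ht₀ h₁' h₂' c₄ h₀))))
  by_cases c₅ : (z ≤ t₂ ∧ t₂ ≤ t₀ ∧ t₀ ≤ t₁) ∨ (t₁ ≤ t₀ ∧ t₀ ≤ t₂ ∧ t₂ ≤ z)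
  · exact mem_sup_right (mem_sup_left (mem_sup_right
      (key hu₂ hu₀ ht₂ ht₀ ht₁ h₂' h₀' c₅ h₁)))
  · exact mem_sup_right (mem_sup_right
      (key hu₂ hu₁ ht₂ ht₁ ht₀ h₂' h₁' (by grind) h₀))

end Co

/-! ### The identities read at a join-irreducible element -/

section Identities

variable {M : Type u} [Lattice M]

/-- The five identities that define the lattices of convex subsets of chains. -/
structure ChainIdentities (M : Type u) [Lattice M] : Prop where
  hs : LatticeIdentity.HS.Holds M
  u : LatticeIdentity.U.Holds M
  b : LatticeIdentity.B.Holds M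
  e : LatticeIdentity.E.Holds M
  p : LatticeIdentity.P.Holds M

/-- Join-irreducibility is weaker than join-primeness, so the bound by `p` has to be carried along.
With it, the lemma can be applied repeatedly to break up a nested join. -/
theorem SupIrred.sup_le_and_imp {p x y : M} {C : Prop} (hp : SupIrred p)
    (hx : x ≤ p ∧ (p ≤ x → C)) (hy : y ≤ p ∧ (p ≤ y → C)) :
    x ⊔ y ≤ p ∧ (p ≤ x ⊔ y → C) :=
  ⟨sup_le hx.1 hy.1, fun h => (hp.2 (le_antisymm (sup_le hx.1 hy.1) h)).elim
    (fun h => hx.2 h.ge) fun h => hy.2 h.ge⟩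

namespace ChainIdentities

/-- This is (U): `p` has at most two sides. -/
theorem le_of_le_sups (hM : ChainIdentities M) {p : M} (hp : SupIrred p)
    {x₀ x₁ x₂ : M} (h₀₁ : p ≤ x₀ ⊔ x₁) (h₀₂ : p ≤ x₀ ⊔ x₂)
    (h₁₂ : p ≤ x₁ ⊔ x₂) : p ≤ x₀ ∨ p ≤ x₁ ∨ p ≤ x₂ := by
  have h := (le_inf (le_inf (le_inf le_rfl h₀₁) h₀₂) h₁₂).trans
    (LatticeIdentity.holds_U_iff.1 hM.u p x₀ x₁ x₂)
  refine (hp.sup_le_and_imp (hp.sup_le_and_imp ?_ ?_) ?_).2 h <;>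
    refine ⟨inf_le_left.trans inf_le_left, fun h => ?_⟩ <;>
    simp only [le_inf_iff] at h <;> tauto

theorem le_sups_of_le_sups (hM : ChainIdentities M) {p : M} (hp : SupIrred p)
    {a₀ a₁ b₀ b₁ : M} (ha : p ≤ a₀ ⊔ a₁) (hb : p ≤ b₀ ⊔ b₁)
    (ha₀ : ¬p ≤ a₀) (ha₁ : ¬p ≤ a₁) (hb₀ : ¬p ≤ b₀) (hb₁ : ¬p ≤ b₁) :
    (p ≤ a₀ ⊔ b₀ ∧ p ≤ a₁ ⊔ b₁) ∨ (p ≤ a₀ ⊔ b₁ ∧ p ≤ a₁ ⊔ b₀) := by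
  have h := (le_inf (le_inf le_rfl ha) hb).trans
    (LatticeIdentity.holds_B_iff.1 hM.b p a₀ a₁ b₀ b₁)
  refine (hp.sup_le_and_imp (hp.sup_le_and_imp (hp.sup_le_and_imp (hp.sup_le_and_imp ?_ ?_)
    (hp.sup_le_and_imp ?_ ?_)) ?_) ?_).2 h <;>
    refine ⟨by simp only [inf_assoc]; exact inf_le_left, fun h => ?_⟩ <;>
    simp only [le_inf_iff] at h <;> tauto

/-- This is (HS). By minimality of `b`, a joinand in which `b` has been replaced by `b ⊓ x` can only
be above `p` if `b ≤ x`. -/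
theorem cover_of_le_sup (hM : ChainIdentities M) {p : M} (hp : SupIrred p)
    {b c b₀ b₁ : M} (hpb : p ≤ b ⊔ c) (hb : b ≤ b₀ ⊔ b₁)
    (hmin : ∀ b' ≤ b, p ≤ b' ⊔ c → b' = b) :
    p ≤ b ∨ b ≤ b₀ ∨ b ≤ b₁ ∨ (b ≤ p ⊔ b₀ ∧ p ≤ b₀ ⊔ c ∧ (p ≤ b ⊔ b₁ ∨ p ≤ b₁ ⊔ c)) ∨
      (b ≤ p ⊔ b₁ ∧ p ≤ b₁ ⊔ c ∧ (p ≤ b ⊔ b₀ ∨ p ≤ b₀ ⊔ c)) := by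
  have h := LatticeIdentity.holds_HS_iff.1 hM.hs p b c b₀ b₁
  rw [inf_eq_left.2 hb] at h
  replace h := (le_inf le_rfl hpb).trans h
  have key : ∀ {x : M}, p ≤ b ⊓ x ⊔ c → b ≤ x := fun h => inf_eq_left.1 (hmin _ inf_le_left h)
  refine (hp.sup_le_and_imp (hp.sup_le_and_imp (hp.sup_le_and_imp ?_ (hp.sup_le_and_imp ?_ ?_))
    (hp.sup_le_and_imp ?_ ?_)) (hp.sup_le_and_imp ?_ ?_)).2 h <;>
    refine ⟨by first | exact inf_le_left | exact (inf_le_left.trans inf_le_left).trans inf_le_left,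
      fun h => ?_⟩
  · exact Or.inl (h.trans inf_le_right)
  · exact Or.inr (Or.inl (key (h.trans inf_le_right)))
  · exact Or.inr (Or.inr (Or.inl (key (h.trans inf_le_right))))
  all_goals
    simp only [le_inf_iff] at h
    have := key h.1.1.2
    tauto

theorem cover_of_le_sup_of_le_sup (hM : ChainIdentities M) {p : M} (hp : SupIrred p)
    {b c d b₀ b₁ : M} (hpb : p ≤ b ⊔ c) (hpd : p ≤ c ⊔ d)
    (hb : b ≤ b₀ ⊔ b₁) (hmin : ∀ b' ≤ b, p ≤ b' ⊔ c → b' = b) :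
    p ≤ b ∨ p ≤ d ∨ b ≤ p ⊔ d ∨ (p ≤ b₀ ⊔ c ∧ b ≤ p ⊔ b₀ ∧ b ≤ b₀ ⊔ d) ∨
      (p ≤ b₁ ⊔ c ∧ b ≤ p ⊔ b₁ ∧ b ≤ b₁ ⊔ d) := by
  have h := LatticeIdentity.holds_P_iff.1 hM.p p b c d b₀ b₁
  rw [inf_eq_left.2 hb] at h
  replace h := (le_inf (le_inf le_rfl hpb) hpd).trans h
  have key : ∀ {x : M}, p ≤ b ⊓ x ⊔ c → b ≤ x := fun h => inf_eq_left.1 (hmin _ inf_le_left h)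
  refine (hp.sup_le_and_imp (hp.sup_le_and_imp (hp.sup_le_and_imp ?_ ?_) ?_)
    (hp.sup_le_and_imp ?_ ?_)).2 h <;>
    refine ⟨by simp only [inf_assoc]; exact inf_le_left, fun h => ?_⟩
  · simp only [le_inf_iff] at h
    tauto
  · simp only [le_inf_iff] at h
    tauto
  · exact Or.inr (Or.inr (Or.inl (key (h.trans (inf_le_left.trans inf_le_right)))))
  all_goals
    rw [inf_assoc b] at h
    simp only [le_inf_iff] at h
    have := le_inf_iff.1 (key h.1.2)
    tauto

/-- This is (E): three minimal partners of the same `a` can be sorted by distance from `p`.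
Minimality turns the shrunken `bᵢ ⊓ x` into `bᵢ ≤ x`. -/
theorem exists_sorted (hM : ChainIdentities M) {p : M} (hp : SupIrred p)
    {a b₀ b₁ b₂ : M} (h₀ : p ≤ a ⊔ b₀) (h₁ : p ≤ a ⊔ b₁) (h₂ : p ≤ a ⊔ b₂)
    (hb₀ : ¬p ≤ b₀) (hb₁ : ¬p ≤ b₁) (hb₂ : ¬p ≤ b₂)
    (hmin₀ : ∀ b ≤ b₀, p ≤ a ⊔ b → b = b₀) (hmin₁ : ∀ b ≤ b₁, p ≤ a ⊔ b → b = b₁)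
    (hmin₂ : ∀ b ≤ b₂, p ≤ a ⊔ b → b = b₂) :
    (b₀ ≤ p ⊔ b₁ ∧ b₁ ≤ p ⊔ b₂ ∧ b₁ ≤ b₀ ⊔ b₂) ∨ (b₀ ≤ p ⊔ b₂ ∧ b₂ ≤ p ⊔ b₁ ∧ b₂ ≤ b₀ ⊔ b₁) ∨
    (b₁ ≤ p ⊔ b₀ ∧ b₀ ≤ p ⊔ b₂ ∧ b₀ ≤ b₁ ⊔ b₂) ∨ (b₁ ≤ p ⊔ b₂ ∧ b₂ ≤ p ⊔ b₀ ∧ b₂ ≤ b₁ ⊔ b₀) ∨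
    (b₂ ≤ p ⊔ b₀ ∧ b₀ ≤ p ⊔ b₁ ∧ b₀ ≤ b₂ ⊔ b₁) ∨
    (b₂ ≤ p ⊔ b₁ ∧ b₁ ≤ p ⊔ b₀ ∧ b₁ ≤ b₂ ⊔ b₀) := by
  have h := (le_inf le_rfl (le_inf (le_inf h₀ h₁) h₂)).trans
    (LatticeIdentity.holds_E_iff.1 hM.e p a b₀ b₁ b₂)
  have key₀ : ∀ {x : M}, p ≤ a ⊔ b₀ ⊓ x → b₀ ≤ x :=
    fun h => inf_eq_left.1 (hmin₀ _ inf_le_left h)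
  have key₁ : ∀ {x : M}, p ≤ a ⊔ b₁ ⊓ x → b₁ ≤ x :=
    fun h => inf_eq_left.1 (hmin₁ _ inf_le_left h)
  have key₂ : ∀ {x : M}, p ≤ a ⊔ b₂ ⊓ x → b₂ ≤ x :=
    fun h => inf_eq_left.1 (hmin₂ _ inf_le_left h)
  simp only [inf_assoc b₀, inf_assoc b₁, inf_assoc b₂] at h
  refine (hp.sup_le_and_imp (hp.sup_le_and_imp (hp.sup_le_and_imp ?_ ?_) ?_)
    (hp.sup_le_and_imp (hp.sup_le_and_imp (hp.sup_le_and_imp (hp.sup_le_and_imp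
      (hp.sup_le_and_imp ?_ ?_) ?_) ?_) ?_) ?_)).2 h <;>
    refine ⟨by simp only [inf_assoc]; exact inf_le_left, fun h => ?_⟩
  · exact absurd (h.trans (inf_le_left.trans inf_le_right)) hb₀
  · exact absurd (h.trans (inf_le_left.trans inf_le_right)) hb₁
  · exact absurd (h.trans (inf_le_left.trans inf_le_right)) hb₂
  all_goals rw [le_inf_iff, le_inf_iff, le_inf_iff] at h
  · exact Or.inl ⟨key₀ h.1.1.2, le_inf_iff.1 (key₁ h.1.2)⟩
  · exact Or.inr (Or.inl ⟨key₀ h.1.1.2, le_inf_iff.1 (key₂ h.1.2)⟩)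
  · exact Or.inr (Or.inr (Or.inl ⟨key₁ h.1.1.2, le_inf_iff.1 (key₀ h.1.2)⟩))
  · exact Or.inr (Or.inr (Or.inr (Or.inl ⟨key₁ h.1.1.2, le_inf_iff.1 (key₂ h.1.2)⟩)))
  · exact Or.inr (Or.inr (Or.inr (Or.inr (Or.inl ⟨key₂ h.1.1.2, le_inf_iff.1 (key₀ h.1.2)⟩))))
  · exact Or.inr (Or.inr (Or.inr (Or.inr (Or.inr ⟨key₂ h.1.1.2, le_inf_iff.1 (key₁ h.1.2)⟩))))

end ChainIdentities

end Identities

/-! ### Minimal covers and the two sides of a join-irreducible -/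

section MinimalCovers

variable {M : Type u} [Lattice M]

/-- A weak form of lower continuity together with spatiality: join-irreducible elements separate
the elements of the lattice, and elements that complete a cover of `p` can be chosen minimal. -/
structure HasMinimalCovers (M : Type u) [Lattice M] : Prop where
  exists_supIrred_not_le : ∀ x y : M, ¬x ≤ y → ∃ q ≤ x, SupIrred q ∧ ¬q ≤ y
  exists_minimal_left : ∀ p a b : M, p ≤ a ⊔ b → ∃ u ≤ a, p ≤ u ⊔ b ∧ ∀ u' ≤ u, p ≤ u' ⊔ b → u' = u

/-- `{u, v}` is a minimal nontrivial join-cover of `p`. -/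
structure MinCover (p u v : M) : Prop where
  le : p ≤ u ⊔ v
  not_le_left : ¬p ≤ u
  not_le_right : ¬p ≤ v
  left_min : ∀ u' ≤ u, p ≤ u' ⊔ v → u' = u
  right_min : ∀ v' ≤ v, p ≤ u ⊔ v' → v' = v

theorem HasMinimalCovers.exists_minCover (hC : HasMinimalCovers M) {p a b : M} (h : p ≤ a ⊔ b)
    (ha : ¬p ≤ a) (hb : ¬p ≤ b) : ∃ u ≤ a, ∃ v ≤ b, MinCover p u v := by
  obtain ⟨u, hua, hu, hu'⟩ := hC.exists_minimal_left p a b h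
  obtain ⟨v, hvb, hv, hv'⟩ := hC.exists_minimal_left p b u (sup_comm u b ▸ hu)
  refine ⟨u, hua, v, hvb, sup_comm v u ▸ hv, fun h => ha (h.trans hua), fun h => hb (h.trans hvb),
    fun u' h h' => hu' u' h (h'.trans (sup_le_sup_left hvb _)), fun v' h h' => hv' v' h ?_⟩
  rwa [sup_comm]

namespace MinCover

variable {p q r u v a b c : M}

theorem symm (h : MinCover p u v) : MinCover p v u where
  le := sup_comm u v ▸ h.le
  not_le_left := h.not_le_right
  not_le_right := h.not_le_left
  left_min v' hv h' := h.right_min v' hv (sup_comm v' u ▸ h')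
  right_min u' hu h' := h.left_min u' hu (sup_comm v u' ▸ h')

theorem eq_and_eq {u' v' : M} (h : MinCover p u v) (hu : u' ≤ u) (hv : v' ≤ v)
    (h' : p ≤ u' ⊔ v') : u' = u ∧ v' = v :=
  ⟨h.left_min _ hu (h'.trans (sup_le_sup_left hv _)),
    h.right_min _ hv (h'.trans (sup_le_sup_right hu _))⟩

theorem supIrred_left (hM : ChainIdentities M) (hp : SupIrred p) (h : MinCover p u v) :
    SupIrred u := by
  refine ⟨fun hu => h.not_le_right (h.le.trans (sup_le ?_ le_rfl)), fun r s hrs => ?_⟩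
  · exact (hu (inf_le_left : u ⊓ v ≤ u)).trans inf_le_right
  have hr : r ≤ u := hrs ▸ le_sup_left
  have hs : s ≤ u := hrs ▸ le_sup_right
  obtain h' | h' | h' | h' | h' := hM.cover_of_le_sup hp h.le hrs.ge h.left_min
  · exact absurd h' h.not_le_left
  · exact Or.inl (hr.antisymm h')
  · exact Or.inr (hs.antisymm h')
  · exact Or.inl (h.left_min r hr h'.2.1)
  · exact Or.inr (h.left_min s hs h'.2.1)

theorem not_le_sup (hM : ChainIdentities M) (hp : SupIrred p) (hq : MinCover p q c)
    (hr : MinCover p r c) : ¬p ≤ q ⊔ r := fun h =>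
  (hM.le_of_le_sups hp h hq.le hr.le).elim hq.not_le_left
    fun h => h.elim hr.not_le_left hr.not_le_right

/-- Shrinking the cover could also shrink `q` to `q'`. By (B) against `{q, u}`, `p ≤ u ⊔ q'`, and
minimality of `q` in its own cover gives `q' = q`. -/
theorem exists_of_le_sup (hM : ChainIdentities M) (hC : HasMinimalCovers M) (hp : SupIrred p)
    (hq : MinCover p q u) (h : p ≤ q ⊔ b) (hb : ¬p ≤ b) : ∃ v ≤ b, MinCover p q v := by
  obtain ⟨q', hq', v, hv, hqv⟩ := hC.exists_minCover h hq.not_le_left hb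
  refine ⟨v, hv, ?_⟩
  obtain ⟨h, -⟩ | ⟨-, h⟩ := hM.le_sups_of_le_sups hp hq.le hqv.le hq.not_le_left hq.not_le_right
    hqv.not_le_left hqv.not_le_right
  · exact absurd (h.trans (sup_le le_rfl hq')) hq.not_le_left
  · rwa [← hq.left_min q' hq' (sup_comm u q' ▸ h)]

theorem of_le_sup (hM : ChainIdentities M) (hC : HasMinimalCovers M) (hp : SupIrred p)
    (hq : MinCover p q u) (hr : MinCover p r v) (h : p ≤ q ⊔ r) : MinCover p q r := by
  obtain ⟨v', hv', hqv⟩ := hq.exists_of_le_sup hM hC hp h hr.not_le_left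
  obtain ⟨h, -⟩ | ⟨-, h⟩ := hM.le_sups_of_le_sups hp hr.le hqv.symm.le hr.not_le_left
    hr.not_le_right hqv.not_le_right hqv.not_le_left
  · exact absurd (h.trans (sup_le le_rfl hv')) hr.not_le_left
  · rwa [← hr.left_min v' hv' (sup_comm v v' ▸ h)]

/-- Elements on the same side of `p` have the same partners. -/
theorem of_not_le_sup (hM : ChainIdentities M) (hC : HasMinimalCovers M) (hp : SupIrred p)
    (hq : MinCover p q c) (hr : MinCover p r v) (h : ¬p ≤ q ⊔ r) : MinCover p r c := by
  obtain ⟨h', -⟩ | ⟨-, h'⟩ := hM.le_sups_of_le_sups hp hq.le hr.le hq.not_le_left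
    hq.not_le_right hr.not_le_left hr.not_le_right
  · exact absurd h' h
  · exact hr.of_le_sup hM hC hp hq.symm (sup_comm c r ▸ h')

theorem exists_side (hM : ChainIdentities M) (hC : HasMinimalCovers M) (hp : SupIrred p) :
    ∃ s : M → Prop, ∀ q r u v, MinCover p q u → MinCover p r v → (p ≤ q ⊔ r ↔ (s q ↔ ¬s r)) := by
  by_cases hN : ∃ c d, MinCover p c d
  · obtain ⟨c, d, hc⟩ := hN
    -- A side is named by a reference element `c`: the predicate holds for the elements opposite to
    -- `c`.
    refine ⟨fun q => p ≤ c ⊔ q, fun q r u v hq hr => ?_⟩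
    by_cases h₁ : p ≤ c ⊔ q <;> by_cases h₂ : p ≤ c ⊔ r <;> simp only [h₁, h₂]
    · simpa using (hq.of_le_sup hM hC hp hc (sup_comm c q ▸ h₁)).not_le_sup hM hp
        (hr.of_le_sup hM hC hp hc (sup_comm c r ▸ h₂))
    · simpa using ((hc.of_le_sup hM hC hp hq h₁).of_not_le_sup hM hC hp hr h₂).symm.le
    · simpa using ((hc.of_le_sup hM hC hp hr h₂).of_not_le_sup hM hC hp hq h₁).le
    · simpa using (hc.of_not_le_sup hM hC hp hq h₁).not_le_sup hM hp
        (hc.of_not_le_sup hM hC hp hr h₂)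
  · exact ⟨fun _ => True, fun q r u v hq => absurd ⟨q, u, hq⟩ hN⟩

theorem le_total (hM : ChainIdentities M) (hp : SupIrred p) (hq : MinCover p q c)
    (hr : MinCover p r c) : q ≤ p ⊔ r ∨ r ≤ p ⊔ q := by
  -- Sorting three elements, two of them equal to `r`, compares `q` with `r`.
  have := hM.exists_sorted hp hq.symm.le hr.symm.le hr.symm.le hq.not_le_left hr.not_le_left
    hr.not_le_left hq.symm.right_min hr.symm.right_min hr.symm.right_min
  tauto

theorem le_antisymm (hM : ChainIdentities M) (hC : HasMinimalCovers M) (hp : SupIrred p)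
    (hq : MinCover p q c) (hr : MinCover p r c) (hqr : q ≤ p ⊔ r) (hrq : r ≤ p ⊔ q) : q = r := by
  have hpqc : q ⊔ c ≤ r ⊔ c := sup_le (hqr.trans (sup_le hr.le le_sup_left)) le_sup_right
  have hrqc : r ≤ q ⊔ c := hrq.trans (sup_le hq.le le_sup_left)
  have hqc : ¬q ≤ c := fun h => hq.not_le_right (hq.le.trans (sup_le h le_rfl))
  have hrc : ¬r ≤ c := fun h => hr.not_le_right (hr.le.trans (sup_le h le_rfl))
  by_cases h : q ≤ r
  · exact hr.left_min q h hq.le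
  exfalso
  -- A minimal cover of `q` inside `r ⊔ c` must use all of `r`, because `r` is minimal with `c` over
  -- `p`. Then (HS) for this cover and `r ≤ q ⊔ c` leaves no case.
  obtain ⟨x, hx, y, hy, hxy⟩ := hC.exists_minCover (le_sup_left.trans hpqc) h hqc
  obtain rfl : x = r := hr.left_min x hx
    (hq.le.trans (sup_le (hxy.le.trans (sup_le_sup_left hy _)) le_sup_right))
  obtain h' | h' | h' | h' | h' :=
    hM.cover_of_le_sup (hq.supIrred_left hM hp) hxy.le hrqc hxy.left_min
  · exact h h'
  · exact h (hq.left_min _ h' hr.le).ge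
  · exact hrc h'
  · exact h (hq.left_min _ (h'.1.trans (sup_idem _).le) hr.le).ge
  · exact hqc (h'.2.1.trans (sup_le le_rfl hy))

/-- `exists_sorted` does not say which order occurs. Any order other than the given one forces two
neighbours to coincide by antisymmetry, and the claim is then trivial. -/
theorem le_sup_of_le_of_le (hM : ChainIdentities M) (hC : HasMinimalCovers M) (hp : SupIrred p)
    {b₀ b₁ b₂ : M} (h₀ : MinCover p b₀ c) (h₁ : MinCover p b₁ c) (h₂ : MinCover p b₂ c)
    (h₀₁ : b₀ ≤ p ⊔ b₁) (h₁₂ : b₁ ≤ p ⊔ b₂) : b₁ ≤ b₀ ⊔ b₂ := by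
  have htrans : ∀ {x y z : M}, x ≤ p ⊔ y → y ≤ p ⊔ z → x ≤ p ⊔ z :=
    fun h h' => h.trans (sup_le le_sup_left h')
  have e₀₁ : b₁ ≤ p ⊔ b₀ → b₁ ≤ b₀ ⊔ b₂ := fun h =>
    (h₀.le_antisymm hM hC hp h₁ h₀₁ h).ge.trans le_sup_left
  have e₁₂ : b₂ ≤ p ⊔ b₁ → b₁ ≤ b₀ ⊔ b₂ := fun h =>
    (h₁.le_antisymm hM hC hp h₂ h₁₂ h).le.trans le_sup_right
  obtain h | h | h | h | h | h := hM.exists_sorted hp h₀.symm.le h₁.symm.le h₂.symm.le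
    h₀.not_le_left h₁.not_le_left h₂.not_le_left h₀.symm.right_min h₁.symm.right_min
    h₂.symm.right_min
  · exact h.2.2
  · exact e₁₂ h.2.1
  · exact e₀₁ h.1
  · exact e₁₂ (htrans h.2.1 h₀₁)
  · exact e₁₂ (htrans h.1 h₀₁)
  · exact e₀₁ h.2.1

/-- Here `b₁` is beyond `b` as seen from `p`, and `b₀` turns out to be `p`, across `p`, or between
`p` and `b`. The method is to find `e ≤ b₀` and `d ≤ b₁` that lie in minimal covers of `p` and still
satisfy `b ≤ e ⊔ d`; minimality of `{b₀, b₁}` then gives equality. -/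
theorem hereditary_aux (hM : ChainIdentities M) (hC : HasMinimalCovers M) (hp : SupIrred p)
    {b₀ b₁ : M} (hb : MinCover p b c) (h : MinCover b b₀ b₁) (h₁ : b ≤ p ⊔ b₁) (h₂ : p ≤ b₁ ⊔ c)
    (h₃ : p ≤ b ⊔ b₀ ∨ p ≤ b₀ ⊔ c) :
    MinCover p b₁ c ∧ (b₀ = p ∨ MinCover p b b₀ ∨ (MinCover p b₀ c ∧ b₀ ≤ p ⊔ b)) := by
  have hpb₁ : ¬p ≤ b₁ := fun h' => h.not_le_right (h₁.trans (sup_le h' le_rfl))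
  have hbc : ¬b ≤ c := fun h => hb.not_le_right (hb.le.trans (sup_le h le_rfl))
  obtain ⟨d, hd, hcd⟩ := hb.symm.exists_of_le_sup hM hC hp (sup_comm b₁ c ▸ h₂) hpb₁
  -- (P) ensures that `d`, though possibly smaller than `b₁`, is still beyond `b`.
  have hbd : b ≤ p ⊔ d := by
    obtain h' | h' | h' | h' | h' :=
      hM.cover_of_le_sup_of_le_sup hp hb.le hcd.le h.le hb.left_min
    · exact absurd h' hb.not_le_left
    · exact absurd h' hcd.not_le_right
    · exact h'
    · rwa [h.right_min d hd h'.2.2]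
    · exact absurd (h'.2.2.trans (sup_le le_rfl hd)) h.not_le_right
  by_cases hpb₀ : p ≤ b₀
  · have hd₁ := h.right_min d hd (hbd.trans (sup_le_sup_right hpb₀ _))
    exact ⟨hd₁ ▸ hcd.symm, Or.inl (h.left_min p hpb₀ h₁).symm⟩
  obtain h₃ | h₃ := h₃
  · obtain ⟨e, he, hbe⟩ := hb.exists_of_le_sup hM hC hp h₃ hpb₀
    obtain ⟨h', -⟩ | ⟨-, h'⟩ := hM.le_sups_of_le_sups hp hbe.le hcd.symm.le hbe.not_le_left
      hbe.not_le_right hcd.not_le_right hcd.not_le_left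
    · exact absurd h' (hb.not_le_sup hM hp hcd.symm)
    · obtain ⟨rfl, rfl⟩ := h.eq_and_eq he hd (hbd.trans (sup_le h' le_sup_right))
      exact ⟨hcd.symm, Or.inr (Or.inl hbe)⟩
  · obtain ⟨e, he, hce⟩ := hb.symm.exists_of_le_sup hM hC hp (sup_comm b₀ c ▸ h₃) hpb₀
    obtain h' | h' := hb.le_total hM hp hce.symm
    · obtain h'' | h'' | h'' := hM.le_of_le_sups (hb.supIrred_left hM hp) h.le (x₂ := c)
        (h'.trans (sup_le h₃ (he.trans le_sup_left))) (h₁.trans (sup_le h₂ le_sup_left))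
      · exact absurd h'' h.not_le_left
      · exact absurd h'' h.not_le_right
      · exact absurd h'' hbc
    · obtain ⟨rfl, rfl⟩ := h.eq_and_eq he hd
        (hce.symm.le_sup_of_le_of_le hM hC hp hb hcd.symm h' hbd)
      exact ⟨hcd.symm, Or.inr (Or.inr ⟨hce.symm, h'⟩)⟩

theorem hereditary (hM : ChainIdentities M) (hC : HasMinimalCovers M) (hp : SupIrred p)
    {b₀ b₁ : M} (hb : MinCover p b c) (h : MinCover b b₀ b₁) :
    (MinCover p b₁ c ∧ b ≤ p ⊔ b₁ ∧
      (b₀ = p ∨ MinCover p b b₀ ∨ (MinCover p b₀ c ∧ b₀ ≤ p ⊔ b))) ∨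
    (MinCover p b₀ c ∧ b ≤ p ⊔ b₀ ∧
      (b₁ = p ∨ MinCover p b b₁ ∨ (MinCover p b₁ c ∧ b₁ ≤ p ⊔ b))) := by
  obtain h' | h' | h' | ⟨h₁, h₂, h₃⟩ | ⟨h₁, h₂, h₃⟩ :=
    hM.cover_of_le_sup hp hb.le h.le hb.left_min
  · exact absurd h' hb.not_le_left
  · exact absurd h' h.not_le_left
  · exact absurd h' h.not_le_right
  · have := hb.hereditary_aux hM hC hp h.symm h₁ h₂ h₃
    exact Or.inr ⟨this.1, h₁, this.2⟩
  · have := hb.hereditary_aux hM hC hp h h₁ h₂ h₃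
    exact Or.inl ⟨this.1, h₁, this.2⟩

end MinCover

end MinimalCovers

/-! ### The linear order on the dependency chain -/

section DependencyChain

/-- The linear order that sorts elements by rank, then by `R` at nonnegative rank and by the
converse of `R` at negative rank. -/
@[reducible]
noncomputable def LinearOrder.ofRank {α : Type u} (σ : α → ℤ) (R : α → α → Prop)
    (refl : ∀ a, R a a) (trans : ∀ a b c, R a b → R b c → R a c)
    (total : ∀ a b, σ a = σ b → R a b ∨ R b a)
    (antisymm : ∀ a b, σ a = σ b → R a b → R b a → a = b) : LinearOrder α where
  le a b := σ a < σ b ∨ (σ a = σ b ∧ ((0 ≤ σ a ∧ R a b) ∨ (σ a < 0 ∧ R b a)))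
  le_refl a := Or.inr ⟨rfl, (le_or_gt 0 (σ a)).imp (fun h => ⟨h, refl a⟩) fun h => ⟨h, refl a⟩⟩
  le_trans a b c := by
    rintro (h | ⟨h, ⟨h', hR⟩ | ⟨h', hR⟩⟩) (k | ⟨k, ⟨k', kR⟩ | ⟨k', kR⟩⟩)
    · exact Or.inl (h.trans k)
    · exact Or.inl (h.trans_eq k)
    · exact Or.inl (h.trans_eq k)
    · exact Or.inl (h.trans_lt k)
    · exact Or.inr ⟨h.trans k, Or.inl ⟨h', trans _ _ _ hR kR⟩⟩
    · omega
    · exact Or.inl (h.trans_lt k)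
    · omega
    · exact Or.inr ⟨h.trans k, Or.inr ⟨h', trans _ _ _ kR hR⟩⟩
  le_antisymm a b := by
    rintro (h | ⟨h, ⟨h', hR⟩ | ⟨h', hR⟩⟩) (k | ⟨k, ⟨k', kR⟩ | ⟨k', kR⟩⟩)
    all_goals first
      | omega
      | exact antisymm a b h hR kR
      | exact antisymm a b h kR hR
  le_total a b := by
    have := total a b
    have := total b a
    grind
  toDecidableLE := Classical.decRel _

variable {M : Type u} [Lattice M]

/-- The elements that occur in minimal join-covers of `p`, together with `p` itself. -/
@[ext]
structure DepChain (p : M) : Type u where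
  val : M
  mem : val = p ∨ ∃ r, MinCover p val r

theorem DepChain.supIrred (hM : ChainIdentities M) {p : M} (hp : SupIrred p) (q : DepChain p) :
    SupIrred q.val := by
  obtain h | ⟨r, h⟩ := q.mem
  · rwa [h]
  · exact h.supIrred_left hM hp

theorem exists_linearOrder_depChain (hM : ChainIdentities M) (hC : HasMinimalCovers M) {p : M}
    (hp : SupIrred p) : ∃ _ : LinearOrder (DepChain p),
      (∀ u q v : DepChain p, u ≤ q → q ≤ v → q.val ≤ u.val ⊔ v.val) ∧
      ∀ (q : DepChain p) (u v : M), MinCover q.val u v → ∃ u' v' : DepChain p,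
        u'.val = u ∧ v'.val = v ∧ ((u' ≤ q ∧ q ≤ v') ∨ (v' ≤ q ∧ q ≤ u')) := by
  classical
  obtain ⟨s, hs⟩ := MinCover.exists_side hM hC hp
  -- Rank 0 is `p` itself; ranks 1 and -1 are its two sides.
  let σ : DepChain p → ℤ := fun q => if q.val = p then 0 else if s q.val then 1 else -1
  have hσp : ∀ q : DepChain p, q.val = p → σ q = 0 := fun q h => if_pos h
  have hσ₁ : ∀ (q : DepChain p) r, MinCover p q.val r → s q.val → σ q = 1 := fun q r h h' => by
    have : q.val ≠ p := fun e => h.not_le_left e.ge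
    simp [σ, this, h']
  have hσ₂ : ∀ (q : DepChain p) r, MinCover p q.val r → ¬s q.val → σ q = -1 := fun q r h h' => by
    have : q.val ≠ p := fun e => h.not_le_left e.ge
    simp [σ, this, h']
  have hσ : ∀ q : DepChain p, (σ q = 0 ∧ q.val = p) ∨
      (σ q = 1 ∧ s q.val ∧ ∃ r, MinCover p q.val r) ∨
        (σ q = -1 ∧ ¬s q.val ∧ ∃ r, MinCover p q.val r) := by
    intro q
    obtain h | ⟨r, h⟩ := q.mem
    · exact Or.inl ⟨hσp q h, h⟩
    · by_cases h' : s q.val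
      · exact Or.inr (Or.inl ⟨hσ₁ q r h h', h', r, h⟩)
      · exact Or.inr (Or.inr ⟨hσ₂ q r h h', h', r, h⟩)
  have same : ∀ {q r : DepChain p} {c : M}, σ q = σ r → MinCover p q.val c →
      MinCover p r.val c := by
    intro q r c h hq
    obtain ⟨h₁, e₁⟩ | ⟨h₁, s₁, -⟩ | ⟨h₁, s₁, -⟩ := hσ q
    · exact absurd e₁.ge hq.not_le_left
    all_goals
      obtain ⟨h₂, e₂⟩ | ⟨h₂, s₂, v, hr⟩ | ⟨h₂, s₂, v, hr⟩ := hσ r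
      all_goals first
        | omega
        | exact hq.of_not_le_sup hM hC hp hr (by rw [hs _ _ _ _ hq hr]; tauto)
  have exists_cover : ∀ {q : DepChain p}, σ q ≠ 0 → ∃ c, MinCover p q.val c := by
    intro q h
    obtain h' | h' | h' := hσ q
    · exact absurd h'.1 h
    · exact h'.2.2
    · exact h'.2.2
  have eq_of_zero : ∀ {q : DepChain p}, σ q = 0 → q.val = p := by
    intro q h
    obtain h' | h' | h' := hσ q
    · exact h'.2
    all_goals omega
  have diff : ∀ {q r : DepChain p}, σ q ≠ σ r → p ≤ q.val ⊔ r.val := by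
    intro q r h
    by_cases hq : σ q = 0
    · exact (eq_of_zero hq).ge.trans le_sup_left
    by_cases hr : σ r = 0
    · exact (eq_of_zero hr).ge.trans le_sup_right
    obtain h₁ | ⟨h₁, s₁, u, hq⟩ | ⟨h₁, s₁, u, hq⟩ := hσ q
    · omega
    all_goals
      obtain h₂ | ⟨h₂, s₂, v, hr⟩ | ⟨h₂, s₂, v, hr⟩ := hσ r
      all_goals first
        | omega
        | rw [hs _ _ _ _ hq hr]; tauto
  -- Distance from `p` increases upwards on the positive side and downwards on the negative side, so
  -- the relation is reversed there.
  let _ : LinearOrder (DepChain p) := LinearOrder.ofRank σ (fun q r => q.val ≤ p ⊔ r.val)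
    (fun q => le_sup_right) (fun q r t h h' => h.trans (sup_le le_sup_left h'))
    (fun q r h => by
      by_cases h' : σ q = 0
      · exact Or.inl ((eq_of_zero h').le.trans le_sup_left)
      · obtain ⟨c, hc⟩ := exists_cover h'
        exact hc.le_total hM hp (same h hc))
    (fun q r h hqr hrq => by
      by_cases h' : σ q = 0
      · exact DepChain.ext ((eq_of_zero h').trans (eq_of_zero (h.symm.trans h')).symm)
      · obtain ⟨c, hc⟩ := exists_cover h'
        exact DepChain.ext (hc.le_antisymm hM hC hp (same h hc) hqr hrq))
  have le_iff : ∀ {q r : DepChain p}, q ≤ r ↔ σ q < σ r ∨ (σ q = σ r ∧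
      ((0 ≤ σ q ∧ q.val ≤ p ⊔ r.val) ∨ (σ q < 0 ∧ r.val ≤ p ⊔ q.val))) := Iff.rfl
  have conv_same : ∀ {u q v : DepChain p}, σ u = σ q → σ q = σ v → u.val ≤ p ⊔ q.val →
      q.val ≤ p ⊔ v.val → q.val ≤ u.val ⊔ v.val := by
    intro u q v h h' huq hqv
    by_cases h₀ : σ q = 0
    · rw [eq_of_zero h₀, eq_of_zero (h.trans h₀)]
      exact le_sup_left
    · obtain ⟨c, hc⟩ := exists_cover h₀
      exact (same h.symm hc).le_sup_of_le_of_le hM hC hp hc (same h' hc) huq hqv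
  have conv_diff : ∀ {u q v : DepChain p}, σ u ≠ σ v → q.val ≤ p ⊔ v.val → q.val ≤ u.val ⊔ v.val :=
    fun h h' => h'.trans (sup_le (diff h) le_sup_right)
  refine ⟨inferInstance, fun u q v huq hqv => ?_, fun q u v h => ?_⟩
  · rw [le_iff] at huq hqv
    obtain h | ⟨h, ⟨h₀, huq⟩ | ⟨h₀, huq⟩⟩ := huq <;> obtain k | ⟨k, ⟨k₀, hqv⟩ | ⟨k₀, hqv⟩⟩ := hqv
    · refine conv_diff (by omega) ?_
      -- Only three ranks exist, so a rank strictly between two others is that of `p`.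
      have : σ q = 0 := by
        have := hσ u
        have := hσ v
        omega
      exact (eq_of_zero this).le.trans le_sup_left
    · exact conv_diff (by omega) hqv
    · have := hσ u
      omega
    · have := hσ v
      have : σ q = 0 := by omega
      exact (eq_of_zero this).le.trans ((eq_of_zero (h.trans this)).ge.trans le_sup_left)
    · exact conv_same h k huq hqv
    · omega
    · rw [sup_comm]
      exact conv_diff (by omega) huq
    · omega
    · rw [sup_comm]
      exact conv_same k.symm h.symm hqv huq
  · obtain e | ⟨c, hc⟩ := q.mem
    · rw [e] at h
      have hq := hσp q e
      refine ⟨⟨u, Or.inr ⟨v, h⟩⟩, ⟨v, Or.inr ⟨u, h.symm⟩⟩, rfl, rfl, ?_⟩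
      have := (hs _ _ _ _ h h.symm).1 h.le
      by_cases hu : s u
      · have h₁ := hσ₁ ⟨u, Or.inr ⟨v, h⟩⟩ v h hu
        have h₂ := hσ₂ ⟨v, Or.inr ⟨u, h.symm⟩⟩ u h.symm (this.1 hu)
        exact Or.inr ⟨Or.inl (by omega), Or.inl (by omega)⟩
      · have h₁ := hσ₂ ⟨u, Or.inr ⟨v, h⟩⟩ v h hu
        have h₂ := hσ₁ ⟨v, Or.inr ⟨u, h.symm⟩⟩ u h.symm (by tauto)
        exact Or.inl ⟨Or.inl (by omega), Or.inl (by omega)⟩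
    · have hq₀ : σ q ≠ 0 := by
        have := hσ₁ q c hc
        have := hσ₂ q c hc
        by_cases s q.val <;> grind
      have same' : ∀ {y : DepChain p}, MinCover p y.val c → σ q = σ y := fun {y} hy => by
        have h := (hs _ _ _ _ hc hy).not.1 (hc.not_le_sup hM hp hy)
        by_cases hsq : s q.val
        · rw [hσ₁ q c hc hsq, hσ₁ y c hy (by tauto)]
        · rw [hσ₂ q c hc hsq, hσ₂ y c hy (by tauto)]
      -- `y` is on the side of `q` and farther out, while `x` is nearer to `p`, equal to `p`, or
      -- across it. So `q` is between them, in a direction given by the sign of its rank.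
      have key : ∀ {x y : M}, MinCover p y c → q.val ≤ p ⊔ y →
          (x = p ∨ MinCover p q.val x ∨ (MinCover p x c ∧ x ≤ p ⊔ q.val)) →
          ∃ x' y' : DepChain p, x'.val = x ∧ y'.val = y ∧
            ((x' ≤ q ∧ q ≤ y') ∨ (y' ≤ q ∧ q ≤ x')) := by
        intro x y hy hqy hx
        have hy' := same' (y := ⟨y, Or.inr ⟨c, hy⟩⟩) hy
        have hqσ := hσ q
        have hxmem : x = p ∨ ∃ r, MinCover p x r := by
          obtain hx | hx | hx := hx
          · exact Or.inl hx
          · exact Or.inr ⟨q.val, hx.symm⟩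
          · exact Or.inr ⟨c, hx.1⟩
        refine ⟨⟨x, hxmem⟩, ⟨y, Or.inr ⟨c, hy⟩⟩, rfl, rfl, ?_⟩
        have hxq : (σ ⟨x, hxmem⟩ = σ q ∧ x ≤ p ⊔ q.val) ∨ σ ⟨x, hxmem⟩ = 0 ∨
            σ ⟨x, hxmem⟩ = - σ q := by
          obtain hx | hx | hx := hx
          · exact Or.inr (Or.inl (hσp _ hx))
          · refine Or.inr (Or.inr ?_)
            have := (hs _ _ _ _ hx hx.symm).1 hx.le
            by_cases hsq : s q.val
            · rw [hσ₁ q x hx hsq, hσ₂ ⟨x, hxmem⟩ q.val hx.symm (this.1 hsq)]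
            · rw [hσ₂ q x hx hsq, hσ₁ ⟨x, hxmem⟩ q.val hx.symm (by tauto), neg_neg]
          · exact Or.inl ⟨(same' (y := ⟨x, hxmem⟩) hx.1).symm, hx.2⟩
        by_cases hpos : 0 < σ q
        · refine Or.inl ⟨?_, Or.inr ⟨hy', Or.inl ⟨hpos.le, hqy⟩⟩⟩
          obtain h | h | h := hxq
          · exact Or.inr ⟨h.1, Or.inl ⟨by omega, h.2⟩⟩
          · exact Or.inl (by omega)
          · exact Or.inl (by omega)
        · refine Or.inr ⟨Or.inr ⟨hy'.symm, Or.inr ⟨by omega, hqy⟩⟩, ?_⟩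
          obtain h | h | h := hxq
          · exact Or.inr ⟨h.1.symm, Or.inr ⟨by omega, h.2⟩⟩
          · exact Or.inl (by omega)
          · exact Or.inl (by omega)
      obtain ⟨hy, hqy, hx⟩ | ⟨hy, hqy, hx⟩ := hc.hereditary hM hC hp h
      · exact key hy hqy hx
      · obtain ⟨x', y', hx', hy', h⟩ := key hy hqy hx
        exact ⟨y', x', hy', hx', h.symm.imp id id⟩

/-- The elements of the dependency chain below a given element. -/
theorem exists_latticeHom_depChain (hM : ChainIdentities M) (hC : HasMinimalCovers M) {p : M}
    (hp : SupIrred p) : ∃ (_ : LinearOrder (DepChain p)) (φ : LatticeHom M (Co (DepChain p))),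
      ∀ x, (φ x).1 = {q | q.val ≤ x} := by
  obtain ⟨inst, hconv, hcov⟩ := exists_linearOrder_depChain hM hC hp
  refine ⟨inst, ⟨⟨fun x => ⟨{q : DepChain p | q.val ≤ x}, ⟨fun u hu v hv q hq =>
    (hconv u q v hq.1 hq.2).trans (sup_le hu hv)⟩⟩, fun x y => ?_⟩, fun x y => ?_⟩, fun x => rfl⟩
  · refine le_antisymm (fun (q : DepChain p) (hq : q.val ≤ x ⊔ y) => ?_) (sup_le
      (fun (q : DepChain p) (hq : q.val ≤ x) => hq.trans le_sup_left)
      fun (q : DepChain p) (hq : q.val ≤ y) => hq.trans le_sup_right)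
    by_cases hx : q.val ≤ x
    · exact Co.mem_sup_left hx
    by_cases hy : q.val ≤ y
    · exact Co.mem_sup_right hy
    -- Joins are preserved because the minimal cover of `q` found below `x` and `y` consists of
    -- members of the chain that enclose `q`.
    obtain ⟨u, hu, v, hv, huv⟩ := hC.exists_minCover hq hx hy
    obtain ⟨u', v', rfl, rfl, h⟩ := hcov q u v huv
    exact Co.mem_sup_of_between (x := u') (y := v') hu hv h
  · exact Subtype.ext (Set.ext fun q => le_inf_iff)

end DependencyChain

/-! ### Identities under sublattices, quotients and products -/

section Eval

variable {L : Type u} [Lattice L]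

namespace LatticeTerm

theorem eval_mono (t : LatticeTerm) {v w : ℕ → L} (h : ∀ n, v n ≤ w n) : t.eval v ≤ t.eval w := by
  induction t with
  | var n => exact h n
  | meet s t hs ht => exact inf_le_inf hs ht
  | join s t hs ht => exact sup_le_sup hs ht

theorem map_eval {M : Type u} [Lattice M] (f : LatticeHom L M) (t : LatticeTerm) (v : ℕ → L) :
    f (t.eval v) = t.eval fun n => f (v n) := by
  induction t with
  | var n => rfl
  | meet s t hs ht => exact (map_inf f _ _).trans (congrArg₂ _ hs ht)
  | join s t hs ht => exact (map_sup f _ _).trans (congrArg₂ _ hs ht)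

theorem eval_apply {I : Type u} {A : I → Type u} [∀ i, Lattice (A i)] (t : LatticeTerm)
    (v : ℕ → ∀ i, A i) (i : I) : t.eval v i = t.eval fun n => v n i := by
  induction t with
  | var n => rfl
  | meet s t hs ht => exact congrArg₂ _ hs ht
  | join s t hs ht => exact congrArg₂ _ hs ht

end LatticeTerm

namespace LatticeIdentity

variable {e : LatticeIdentity}

theorem Holds.of_injective {M : Type u} [Lattice M] (h : e.Holds M) (f : LatticeHom L M)
    (hf : Function.Injective f) : e.Holds L := fun v =>
  hf (by rw [LatticeTerm.map_eval, LatticeTerm.map_eval, h])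

theorem Holds.of_surjective {M : Type u} [Lattice M] (h : e.Holds L) (f : LatticeHom L M)
    (hf : Function.Surjective f) : e.Holds M := fun v => by
  choose w hw using fun n => hf (v n)
  rw [← funext hw, ← LatticeTerm.map_eval, ← LatticeTerm.map_eval, h]

theorem Holds.pi {I : Type u} {A : I → Type u} [∀ i, Lattice (A i)] (h : ∀ i, e.Holds (A i)) :
    e.Holds (∀ i, A i) := fun v => funext fun i => by
  rw [LatticeTerm.eval_apply, LatticeTerm.eval_apply, h i]

end LatticeIdentity

end Eval

/-! ### The filter lattice -/

/-- The nonempty filters of a lattice. -/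
@[ext]
structure MeetFilter (L : Type u) [Lattice L] : Type u where
  carrier : Set L
  nonempty : carrier.Nonempty
  mem_of_le : ∀ {x y}, x ∈ carrier → x ≤ y → y ∈ carrier
  inf_mem : ∀ {x y}, x ∈ carrier → y ∈ carrier → x ⊓ y ∈ carrier

namespace MeetFilter

variable {L : Type u} [Lattice L]

/-- Filters are ordered by reverse inclusion. -/
instance : PartialOrder (MeetFilter L) where
  le F G := G.carrier ⊆ F.carrier
  le_refl _ := subset_rfl
  le_trans _ _ _ h h' := h'.trans h
  le_antisymm _ _ h h' := MeetFilter.ext (h'.antisymm h)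

instance : Lattice (MeetFilter L) where
  sup F G := ⟨F.carrier ∩ G.carrier,
    ⟨F.nonempty.some ⊔ G.nonempty.some, F.mem_of_le F.nonempty.some_mem le_sup_left,
      G.mem_of_le G.nonempty.some_mem le_sup_right⟩,
    fun h h' => ⟨F.mem_of_le h.1 h', G.mem_of_le h.2 h'⟩,
    fun h h' => ⟨F.inf_mem h.1 h'.1, G.inf_mem h.2 h'.2⟩⟩
  inf F G := ⟨{z | ∃ x ∈ F.carrier, ∃ y ∈ G.carrier, x ⊓ y ≤ z},
    ⟨_, _, F.nonempty.some_mem, _, G.nonempty.some_mem, le_rfl⟩,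
    fun ⟨x, hx, y, hy, h⟩ h' => ⟨x, hx, y, hy, h.trans h'⟩,
    fun ⟨x, hx, y, hy, h⟩ ⟨x', hx', y', hy', h'⟩ =>
      ⟨x ⊓ x', F.inf_mem hx hx', y ⊓ y', G.inf_mem hy hy',
        le_inf ((inf_le_inf inf_le_left inf_le_left).trans h)
          ((inf_le_inf inf_le_right inf_le_right).trans h')⟩⟩
  le_sup_left _ _ := Set.inter_subset_left
  le_sup_right _ _ := Set.inter_subset_right
  sup_le _ _ _ h h' := Set.subset_inter h h'
  inf_le_left _ G x hx := ⟨x, hx, _, G.nonempty.some_mem, inf_le_left⟩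
  inf_le_right F _ y hy := ⟨_, F.nonempty.some_mem, y, hy, inf_le_right⟩
  le_inf F _ _ h h' := fun _ ⟨_, hx, _, hy, hz⟩ => F.mem_of_le (F.inf_mem (h hx) (h' hy)) hz

/-- Terms are monotone and filters are closed under meets, so the choices made for two subterms can
be merged by taking meets. The value of a term on filters is thus determined by its values in `L`,
which is why identities transfer. -/
theorem mem_eval {v : ℕ → MeetFilter L} {t : LatticeTerm} {z : L} :
    z ∈ (t.eval v).carrier ↔ ∃ w : ℕ → L, (∀ n, w n ∈ (v n).carrier) ∧ t.eval w ≤ z := by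
  induction t generalizing z with
  | var n =>
    classical
    refine ⟨fun h => ⟨fun m => if m = n then z else (v m).nonempty.some, fun m => ?_, ?_⟩,
      fun ⟨w, hw, h⟩ => (v n).mem_of_le (hw n) h⟩
    · dsimp only
      split_ifs with hm
      · exact hm ▸ h
      · exact (v m).nonempty.some_mem
    · simp [LatticeTerm.eval]
  | meet s t hs ht =>
    constructor
    · rintro ⟨x, hx, y, hy, h⟩
      obtain ⟨w, hw, hwx⟩ := hs.1 hx
      obtain ⟨w', hw', hwy⟩ := ht.1 hy
      exact ⟨fun n => w n ⊓ w' n, fun n => (v n).inf_mem (hw n) (hw' n),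
        (inf_le_inf ((s.eval_mono fun n => inf_le_left).trans hwx)
          ((t.eval_mono fun n => inf_le_right).trans hwy)).trans h⟩
    · rintro ⟨w, hw, h⟩
      exact ⟨_, hs.2 ⟨w, hw, le_rfl⟩, _, ht.2 ⟨w, hw, le_rfl⟩, h⟩
  | join s t hs ht =>
    constructor
    · rintro ⟨hx, hy⟩
      obtain ⟨w, hw, hwx⟩ := hs.1 hx
      obtain ⟨w', hw', hwy⟩ := ht.1 hy
      exact ⟨fun n => w n ⊓ w' n, fun n => (v n).inf_mem (hw n) (hw' n),
        sup_le ((s.eval_mono fun n => inf_le_left).trans hwx)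
          ((t.eval_mono fun n => inf_le_right).trans hwy)⟩
    · rintro ⟨w, hw, h⟩
      exact ⟨hs.2 ⟨w, hw, le_sup_left.trans h⟩, ht.2 ⟨w, hw, le_sup_right.trans h⟩⟩

theorem holds {e : LatticeIdentity} (h : e.Holds L) : e.Holds (MeetFilter L) := fun v =>
  MeetFilter.ext (Set.ext fun z => by rw [mem_eval, mem_eval]; simp only [h _])

/-- Zorn's lemma: in the reversed order, the union of a chain of filters is its infimum. -/
theorem exists_minimal_le {Q : MeetFilter L → Prop} {F : MeetFilter L} (hF : Q F)
    (hQ : ∀ (c : Set (MeetFilter L)) (U : MeetFilter L), (∀ G ∈ c, Q G) →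
      U.carrier = ⋃ G ∈ c, G.carrier → Q U) :
    ∃ G ≤ F, Q G ∧ ∀ G' ≤ G, Q G' → G' = G := by
  have hchain : ∀ c ⊆ {G : (MeetFilter L)ᵒᵈ | Q (OrderDual.ofDual G)}, IsChain (· ≤ ·) c → ∀ F ∈ c,
      ∃ U ∈ {G : (MeetFilter L)ᵒᵈ | Q (OrderDual.ofDual G)}, ∀ G ∈ c, G ≤ U := by
    intro c hc hchain F hFc
    let U : MeetFilter L :=
      { carrier := ⋃ G ∈ OrderDual.toDual ⁻¹' c, G.carrier
        nonempty := (OrderDual.ofDual F).nonempty.mono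
          (Set.subset_biUnion_of_mem (u := MeetFilter.carrier) (s := OrderDual.toDual ⁻¹' c) hFc)
        mem_of_le := fun {x y} h h' => by
          simp only [Set.mem_iUnion] at h ⊢
          obtain ⟨G, hG, hx⟩ := h
          exact ⟨G, hG, G.mem_of_le hx h'⟩
        inf_mem := fun {x y} h h' => by
          simp only [Set.mem_iUnion] at h h' ⊢
          obtain ⟨G, hG, hx⟩ := h
          obtain ⟨G', hG', hy⟩ := h'
          obtain h | h := hchain.total hG hG'
          · exact ⟨G', hG', G'.inf_mem (h hx) hy⟩
          · exact ⟨G, hG, G.inf_mem hx (h hy)⟩ }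
    exact ⟨OrderDual.toDual U, hQ _ U (fun G hG => hc hG) rfl, fun G hG =>
      Set.subset_biUnion_of_mem (u := MeetFilter.carrier) (s := OrderDual.toDual ⁻¹' c) hG⟩
  obtain ⟨G, hFG, hG⟩ := zorn_le_nonempty₀ _ hchain (OrderDual.toDual F) hF
  exact ⟨OrderDual.ofDual G, hFG, hG.prop, fun G' h h' => le_antisymm h (hG.le_of_ge h' h)⟩

theorem hasMinimalCovers : HasMinimalCovers (MeetFilter L) where
  exists_supIrred_not_le x y h := by
    obtain ⟨g, hg, hgx⟩ := Set.not_subset.1 h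
    -- A filter maximal among those avoiding `g` is join-irreducible, since the join of filters is
    -- their intersection.
    obtain ⟨q, hqx, hgq, hmin⟩ := exists_minimal_le (Q := fun F => g ∉ F.carrier) hgx
      (fun c U hc hU => by simpa [hU] using hc)
    refine ⟨q, hqx, ⟨fun hq => ?_, fun r s hrs => ?_⟩, fun h => hgq (h hg)⟩
    · exact hgq (((hq (inf_le_left : q ⊓ y ≤ q)).trans inf_le_right : q ≤ y) hg)
    · by_cases hr : g ∈ r.carrier
      · exact Or.inr (hmin s (hrs ▸ le_sup_right) fun hs => hgq (hrs ▸ ⟨hr, hs⟩))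
      · exact Or.inl (hmin r (hrs ▸ le_sup_left) hr)
  exists_minimal_left p a b h := by
    refine exists_minimal_le (Q := fun F => p ≤ F ⊔ b) h fun c U hc hU z ⟨hz, hzb⟩ => ?_
    obtain ⟨G, hG, hzG⟩ := Set.mem_iUnion₂.1 (hU ▸ hz)
    exact hc G hG ⟨hzG, hzb⟩

/-- The embedding of a lattice into its filter lattice. -/
def principal : LatticeHom L (MeetFilter L) where
  toFun x := ⟨Set.Ici x, ⟨x, le_rfl⟩, fun h h' => le_trans h h', fun h h' => le_inf h h'⟩
  map_sup' _ _ := MeetFilter.ext (Set.ext fun _ => sup_le_iff)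
  map_inf' _ _ := MeetFilter.ext (Set.ext fun _ =>
    ⟨fun h => ⟨_, le_rfl, _, le_rfl, h⟩, fun ⟨_, hx, _, hy, h⟩ => (inf_le_inf hx hy).trans h⟩)

theorem mem_principal {x y : L} : y ∈ (principal x).carrier ↔ x ≤ y := Iff.rfl

theorem le_principal {F : MeetFilter L} {x : L} : F ≤ principal x ↔ x ∈ F.carrier :=
  ⟨fun h => h (mem_principal.2 le_rfl), fun h _ hy => F.mem_of_le h hy⟩

theorem principal_injective : Function.Injective (principal : LatticeHom L (MeetFilter L)) :=
  fun _ _ h => le_antisymm (le_principal.1 h.le) (le_principal.1 h.ge)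

theorem isBot_principal {x : L} (hx : IsBot x) : IsBot (principal x) := fun _ y _ => hx y

theorem isTop_principal {x : L} (hx : IsTop x) : IsTop (principal x) := fun F =>
  le_principal.2 (F.mem_of_le F.nonempty.some_mem (hx _))

theorem eq_or_isBot_of_le_principal {a : L} (ha : IsLatticeAtom a) {F : MeetFilter L}
    (hF : F ≤ principal a) : F = principal a ∨ IsBot F := by
  obtain ⟨z, hz, hza⟩ := ha
  by_cases hzF : z ∈ F.carrier
  · exact Or.inr fun G y _ => F.mem_of_le hzF (hz y)
  · refine Or.inl (le_antisymm hF fun x hx => ?_)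
    have hax := F.inf_mem (le_principal.1 hF) hx
    obtain h | h := (inf_le_left : a ⊓ x ≤ a).eq_or_lt
    · exact inf_eq_left.1 h
    · exact absurd ((hza.eq_or_eq (hz _) h.le).resolve_right h.ne ▸ hax) hzF

end MeetFilter

theorem HasMinimalCovers.of_finite (L : Type u) [Lattice L] [Finite L] : HasMinimalCovers L where
  exists_supIrred_not_le x y h := by
    obtain ⟨q, hqx, hq⟩ := (Set.toFinite {q | ¬q ≤ y}).exists_le_minimal h
    refine ⟨q, hqx, ⟨fun hmin => hq.prop ((hmin inf_le_left).trans inf_le_right),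
      fun r s hrs => ?_⟩, hq.prop⟩
    have hr : r ≤ q := hrs ▸ le_sup_left
    have hs : s ≤ q := hrs ▸ le_sup_right
    by_cases hry : r ≤ y
    · by_cases hsy : s ≤ y
      · exact absurd (hrs ▸ sup_le hry hsy) hq.prop
      · exact Or.inr (hs.antisymm (hq.le_of_le hsy hs))
    · exact Or.inl (hr.antisymm (hq.le_of_le hry hr))
  exists_minimal_left p a b h := by
    obtain ⟨u, hua, hu⟩ := (Set.toFinite {u | p ≤ u ⊔ b}).exists_le_minimal h
    exact ⟨u, hua, hu.prop, fun u' h h' => h.antisymm (hu.le_of_le h' h)⟩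

/-! ### Assembling the representation -/

section Representation

/-- An isomorphism of chains induces an isomorphism of their lattices of convex subsets. -/
def Co.mapIso {S : Type*} {T : Type*} [PartialOrder S] [PartialOrder T] (e : S ≃o T) :
    Co S ≃o Co T where
  toFun X := ⟨e.symm ⁻¹' X.1, X.2.preimage_mono e.symm.monotone⟩
  invFun X := ⟨e ⁻¹' X.1, X.2.preimage_mono e.monotone⟩
  left_inv X := Subtype.ext (by ext; simp)
  right_inv X := Subtype.ext (by ext; simp)
  map_rel_iff' {X Y} := by
    refine ⟨fun h x hx => ?_, fun h _ hx => h hx⟩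
    have h' : e x ∈ e.symm ⁻¹' Y.1 := h (show e x ∈ e.symm ⁻¹' X.1 by simpa using hx)
    simpa using h'

variable {L : Type u} [Lattice L]

theorem SupIrred.exists_greatest_lt [Finite L] {r : L} (hr : SupIrred r) :
    ∃ s < r, ∀ t < r, t ≤ s := by
  obtain ⟨s, hs⟩ := exists_covBy_of_wellFoundedGT hr.not_isMin
  refine ⟨s, hs.lt, fun t ht => ?_⟩
  have h : s ⊔ t ≤ r := sup_le hs.le ht.le
  obtain h' | h' := hs.eq_or_eq le_sup_left h
  · exact sup_eq_left.1 h'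
  · exact (hr.2 h').elim (fun h => absurd h hs.ne) fun h => absurd h ht.ne

theorem AtomisticLattice.isLatticeAtom [Finite L] (hL : AtomisticLattice L) {r : L}
    (hr : SupIrred r) : IsLatticeAtom r := by
  obtain ⟨s, hs, hrs⟩ := hr.exists_greatest_lt
  obtain ⟨S, hS, hlub⟩ := hL r
  by_contra hna
  exact hs.not_ge (hlub.2 fun a ha => hrs a ((hlub.1 ha).lt_of_ne fun h => hna (h ▸ hS a ha)))

theorem IsLatticeAtom.eq_or_isBot {a m : L} (ha : IsLatticeAtom a) (h : m ≤ a) :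
    m = a ∨ IsBot m := by
  obtain ⟨z, hz, hza⟩ := ha
  exact (hza.eq_or_eq (hz m) h).symm.imp id (by rintro rfl; exact hz)

/-- The third condition of the main theorem. -/
def HasChainRepresentation (L : Type u) [Lattice L] : Prop :=
  ∃ (I : Type u) (T : I → Type u) (_ : ∀ i, LinearOrder (T i))
    (φ : LatticeHom L (∀ i, Co (T i))),
    Function.Injective φ ∧
    (∀ x : L, IsBot x → φ x = ⊥) ∧
    (∀ x : L, IsTop x → φ x = ⊤) ∧
    (Finite L → Cardinal.mk (Σ i, T i) ≤ Cardinal.mk (JoinIrr L) ^ 2) ∧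
    (SubdirectlyIrreducible L →
      (∃ i₀ : I, (∀ i, i = i₀) ∧
        (Finite L → Cardinal.mk (T i₀) = Cardinal.mk (JoinIrr L))) ∧
      (∀ a : L, IsLatticeAtom a → IsLatticeAtom (φ a))) ∧
    (Finite L → AtomisticLattice L → SubdirectlyIrreducible L →
      Nonempty (L ≃o Co (Fin (Nat.card (JoinIrr L)))))

/-- If no `f j` were injective, every kernel would contain the smallest nonzero congruence, and the
family could not separate points. -/
theorem SubdirectlyIrreducible.exists_injective (hL : SubdirectlyIrreducible L) {J : Type*}
    {A : J → Type*} [∀ j, Lattice (A j)] (f : ∀ j, LatticeHom L (A j))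
    (hf : ∀ x y, (∀ j, f j x = f j y) → x = y) : ∃ j, Function.Injective (f j) := by
  obtain ⟨μ, ⟨x, y, hxy, hne⟩, hμ⟩ := hL
  by_contra! h
  refine hne (hf x y fun j => ?_)
  obtain ⟨a, b, hab, hne'⟩ := Function.not_injective_iff.1 (h j)
  exact hμ (LatticeCon.ker (f j)) ⟨a, b, hab, hne'⟩ x y hxy

theorem Co.eq_of_le_of_subsingleton {T : Type u} [LinearOrder T] {X : Co T}
    (h : X.1.Subsingleton) {Y : Co T} (hY : Y ≤ X) (hne : Y.1.Nonempty) : Y = X := by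
  obtain ⟨y, hy⟩ := hne
  exact le_antisymm hY fun x hx => h (hY hy) hx ▸ hy

/-- A lattice homomorphism onto the least element and all singletons is surjective. -/
theorem Co.surjective_of_singletons [Finite L] {T : Type u} [LinearOrder T]
    (ψ : LatticeHom L (Co T)) (hbot : ∃ x, ψ x = ⊥) (hψ : ∀ t : T, ∃ x, (ψ x).1 = {t}) :
    Function.Surjective ψ := by
  intro X
  obtain ⟨z, hz⟩ := hbot
  obtain ⟨y, -, hy⟩ := (Set.toFinite {y | ψ y ≤ X}).exists_le_maximal
    (show ψ z ≤ X from hz ▸ bot_le)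
  refine ⟨y, le_antisymm hy.prop fun t ht => ?_⟩
  obtain ⟨x, hx⟩ := hψ t
  have hxX : ψ x ≤ X := fun s hs => by
    rw [hx] at hs
    exact hs ▸ ht
  have hxy : y ⊔ x ≤ y := hy.le_of_ge (show ψ (y ⊔ x) ≤ X by
    rw [map_sup]
    exact sup_le hy.prop hxX) le_sup_left
  have : ψ x ≤ ψ y := OrderHomClass.mono ψ (le_sup_right.trans hxy)
  exact this (hx ▸ rfl : t ∈ (ψ x).1)

/-- `M` is `L` itself when `L` is finite and the filter lattice otherwise; the hypotheses on `ι`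
list what both cases share. Surjectivity for finite `L` lets join-irreducibles be counted in `L`. -/
theorem hasChainRepresentation_of_embedding {M : Type u} [Lattice M] (hM : ChainIdentities M)
    (hC : HasMinimalCovers M) (ι : LatticeHom L M) (hι : Function.Injective ι)
    (hbot : ∀ x, IsBot x → IsBot (ι x)) (htop : ∀ x, IsTop x → IsTop (ι x))
    (hatom : ∀ a, IsLatticeAtom a → ∀ m ≤ ι a, m = ι a ∨ IsBot m)
    (hfin : Finite L → Function.Surjective ι) : HasChainRepresentation L := by
  have hιle : ∀ {x y : L}, ι x ≤ ι y ↔ x ≤ y := fun {x y} => by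
    rw [← inf_eq_left, ← map_inf, hι.eq_iff, inf_eq_left]
  have hιirr : ∀ {x : L}, Finite L → SupIrred (ι x) → SupIrred x := by
    refine fun {x} _ hx => ⟨fun hmin => hx.not_isMin ?_, fun b c h => ?_⟩
    · intro m hm
      obtain ⟨y, rfl⟩ := hfin ‹_› m
      exact hιle.2 (hmin (hιle.1 hm))
    · exact (hx.2 ((map_sup ι b c).symm.trans (congrArg ι h))).imp (fun h => hι h) fun h => hι h
  have hcard : Finite L → Cardinal.mk (JoinIrr M) ≤ Cardinal.mk (JoinIrr L) := by
    intro h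
    choose g hg using hfin h
    refine Cardinal.mk_le_of_injective
      (f := fun q : JoinIrr M => (⟨g q.1, hιirr h ((hg q.1).symm ▸ q.2)⟩ : JoinIrr L)) ?_
    intro q r hqr
    exact Subtype.ext ((hg q.1).symm.trans ((congrArg (fun x => ι x.1) hqr).trans (hg r.1)))
  choose inst φ hφ using fun p : JoinIrr M => exists_latticeHom_depChain hM hC p.2
  have hφmem : ∀ {p : JoinIrr M} {x : M} {q : DepChain p.1}, q ∈ (φ p x).1 ↔ q.val ≤ x :=
    fun {p x q} => by rw [hφ]; rfl
  have hle : ∀ x y : L, (∀ p, φ p (ι x) = φ p (ι y)) → x ≤ y := by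
    intro x y h
    rw [← hιle]
    by_contra hxy
    obtain ⟨q, hqx, hq, hqy⟩ := hC.exists_supIrred_not_le _ _ hxy
    -- Separation uses only that `q` belongs to its own chain.
    let q' : DepChain q := ⟨q, Or.inl rfl⟩
    have : q' ∈ (φ ⟨q, hq⟩ (ι x)).1 := hφmem.2 hqx
    rw [h] at this
    exact hqy (hφmem.1 this)
  have heq : ∀ x y : L, (∀ p, φ p (ι x) = φ p (ι y)) → x = y := fun x y h =>
    (hle x y h).antisymm (hle y x fun p => (h p).symm)
  -- The index set is a single suitable `p` if `L` is subdirectly irreducible, and all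
  -- join-irreducibles of `M` otherwise.
  obtain ⟨I, f, hf, hsep, hI⟩ : ∃ (I : Type u) (f : I → JoinIrr M), Function.Injective f ∧
      (∀ x y : L, (∀ i, φ (f i) (ι x) = φ (f i) (ι y)) → x = y) ∧
      (SubdirectlyIrreducible L → ∃ i₀ : I, ∀ i, i = i₀) := by
    by_cases hL : SubdirectlyIrreducible L
    · obtain ⟨p, hp⟩ := hL.exists_injective (fun p => (φ p).comp ι) heq
      exact ⟨PUnit, fun _ => p, fun _ _ _ => rfl, fun x y h => hp (h ⟨⟩),
        fun _ => ⟨⟨⟩, fun _ => rfl⟩⟩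
    · exact ⟨_, id, Function.injective_id, heq, fun h => absurd h hL⟩
  have hψbot : ∀ x : L, IsBot x → ∀ i, φ (f i) (ι x) = ⊥ := by
    intro x hx i
    refine le_bot_iff.1 fun q hq => ?_
    exact ((q.supIrred hM (f i).2).not_isMin fun m _ =>
      (hφmem.1 hq).trans (hbot x hx m)).elim
  have hatomψ : ∀ a : L, IsLatticeAtom a → ∀ i, (φ (f i) (ι a)).1.Subsingleton := by
    have key : ∀ (a : L), IsLatticeAtom a → ∀ (i) (q : DepChain (f i).1), q.val ≤ ι a →
        q.val = ι a := fun a ha i q hq => (hatom a ha _ hq).resolve_right fun h =>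
      (q.supIrred hM (f i).2).not_isMin fun m _ => h m
    intro a ha i q hq r hr
    exact DepChain.ext ((key a ha i q (hφmem.1 hq)).trans (key a ha i r (hφmem.1 hr)).symm)
  have hT : ∀ i, Finite L → Cardinal.mk (DepChain (f i).1) ≤ Cardinal.mk (JoinIrr L) := by
    refine fun i h => (Cardinal.mk_le_of_injective
      (f := fun q : DepChain (f i).1 => (⟨q.val, q.supIrred hM (f i).2⟩ : JoinIrr M)) ?_).trans
      (hcard h)
    exact fun q r hqr => DepChain.ext (congrArg Subtype.val hqr)
  -- If `r` were missing from the only chain, `r` and the greatest element below it would have the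
  -- same image.
  have hmem : ∀ i₀ : I, (∀ i, i = i₀) → Finite L → ∀ r : L, SupIrred r →
      ∃ q : DepChain (f i₀).1, q.val = ι r := by
    intro i₀ hi₀ h r hr
    obtain ⟨s, hsr, hs⟩ := hr.exists_greatest_lt
    by_contra! hne
    refine hsr.ne (hsep s r fun i => ?_)
    rw [hi₀ i]
    refine le_antisymm (OrderHomClass.mono _ (hιle.2 hsr.le)) fun q hq => ?_
    obtain ⟨t, ht⟩ := hfin h q.val
    have htr : t ≤ r := hιle.1 (ht ▸ hφmem.1 hq)
    refine hφmem.2 (ht ▸ hιle.2 (hs t (htr.lt_of_ne fun h => hne q (by rw [← ht, h]))))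
  have hcardT : ∀ i₀ : I, (∀ i, i = i₀) → Finite L →
      Cardinal.mk (DepChain (f i₀).1) = Cardinal.mk (JoinIrr L) := by
    intro i₀ hi₀ h
    refine (hT i₀ h).antisymm ?_
    choose g hg using fun r : JoinIrr L => hmem i₀ hi₀ h r.1 r.2
    refine Cardinal.mk_le_of_injective (f := g) fun r s hrs => Subtype.ext (hι ?_)
    rw [← hg r, ← hg s, hrs]
  let Φ : LatticeHom L (∀ i, Co (DepChain (f i).1)) :=
    { toFun := fun x i => φ (f i) (ι x)
      map_sup' := fun x y => funext fun i => map_sup ((φ (f i)).comp ι) x y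
      map_inf' := fun x y => funext fun i => map_inf ((φ (f i)).comp ι) x y }
  have hΦ : Function.Injective Φ := fun x y h => hsep x y fun i => congrFun h i
  refine ⟨I, fun i => DepChain (f i).1, fun i => inst (f i), Φ, hΦ,
    fun x hx => funext (hψbot x hx), fun x hx => funext fun i => top_le_iff.1 fun q _ =>
      hφmem.2 (htop x hx _), fun h => ?_, fun hL => ?_, fun h hat hL => ?_⟩
  · have : Cardinal.mk (Σ i, DepChain (f i).1) ≤ Cardinal.mk (JoinIrr M × JoinIrr M) := by
      refine Cardinal.mk_le_of_injective (f := fun x : Σ i, DepChain (f i).1 =>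
        (f x.1, (⟨x.2.val, x.2.supIrred hM (f x.1).2⟩ : JoinIrr M))) ?_
      rintro ⟨i, q⟩ ⟨j, r⟩ h
      obtain ⟨h₁, h₂⟩ := Prod.ext_iff.1 h
      obtain rfl := hf h₁
      obtain rfl : q = r := DepChain.ext (congrArg Subtype.val h₂)
      rfl
    refine this.trans ?_
    rw [Cardinal.mk_prod, Cardinal.lift_id, pow_two]
    exact mul_le_mul' (hcard h) (hcard h)
  · obtain ⟨i₀, hi₀⟩ := hI hL
    refine ⟨⟨i₀, hi₀, hcardT i₀ hi₀⟩, fun a ha => ?_⟩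
    obtain ⟨z, hz, hza⟩ := id ha
    have hΦz : Φ z = ⊥ := funext (hψbot z hz)
    refine ⟨⊥, fun X => bot_le, bot_lt_iff_ne_bot.2 fun h => hza.ne (hΦ (hΦz.trans h.symm)),
      fun X hX hXa => hXa.ne (funext fun i => ?_)⟩
    refine Co.eq_of_le_of_subsingleton (hatomψ a ha i) (hXa.le i) ?_
    by_contra hne
    -- With a single index, one empty component makes `X` the least element.
    refine hX.ne' (funext fun j => ?_)
    rw [hi₀ j, ← hi₀ i]
    exact Subtype.ext (Set.not_nonempty_iff_eq_empty.1 hne)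
  · obtain ⟨i₀, hi₀⟩ := hI hL
    let ψ : LatticeHom L (Co (DepChain (f i₀).1)) := (φ (f i₀)).comp ι
    have hψ : Function.Injective ψ := fun x y hxy => hsep x y fun i => hi₀ i ▸ hxy
    have hne : Nonempty L := by
      obtain ⟨-, ⟨x, -⟩, -⟩ := hL
      exact ⟨x⟩
    have hsurj : Function.Surjective ψ := by
      refine Co.surjective_of_singletons ψ ?_ fun q => ?_
      · obtain ⟨z, hz⟩ := (Set.finite_univ (α := L)).exists_minimal Set.univ_nonempty
        exact ⟨z, hψbot z (fun x => (hz.le_of_le trivial inf_le_left).trans inf_le_right) i₀⟩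
      · obtain ⟨t, ht⟩ := hfin h q.val
        -- Each member of the chain comes from a join-irreducible of `L`, which is an atom by
        -- atomisticity, so its image is a singleton.
        have hirr : SupIrred t := hιirr h (ht ▸ q.supIrred hM (f i₀).2)
        exact ⟨t, (hatomψ t (hat.isLatticeAtom hirr) i₀).eq_singleton_of_mem
          (hφmem.2 ht.ge)⟩
    have hψle : ∀ {x y : L}, ψ x ≤ ψ y ↔ x ≤ y := fun {x y} => by
      rw [← inf_eq_left, ← map_inf, hψ.eq_iff, inf_eq_left]
    have hTc := hcardT i₀ hi₀ h
    have hJ : Finite (DepChain (f i₀).1) := by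
      rw [← Cardinal.lt_aleph0_iff_finite, hTc, Cardinal.lt_aleph0_iff_finite]
      infer_instance
    let _ := Fintype.ofFinite (DepChain (f i₀).1)
    have e := Fintype.orderIsoFinOfCardEq (DepChain (f i₀).1) (k := Nat.card (JoinIrr L))
      (by rw [← Nat.card_eq_fintype_card, Nat.card, hTc, Nat.card])
    exact ⟨((RelIso.ofSurjective (OrderEmbedding.ofMapLEIff ψ fun _ _ => hψle) hsurj :
      L ≃o Co (DepChain (f i₀).1))).trans (Co.mapIso e.symm)⟩

theorem ChainIdentities.hasChainRepresentation (hL : ChainIdentities L) :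
    HasChainRepresentation L := by
  by_cases hfin : Finite L
  · exact hasChainRepresentation_of_embedding hL (HasMinimalCovers.of_finite L) (LatticeHom.id L)
      Function.injective_id (fun _ h => h) (fun _ h => h) (fun _ ha _ h => ha.eq_or_isBot h)
      fun _ => Function.surjective_id
  · exact hasChainRepresentation_of_embedding (M := MeetFilter L)
      ⟨MeetFilter.holds hL.hs, MeetFilter.holds hL.u, MeetFilter.holds hL.b,
        MeetFilter.holds hL.e, MeetFilter.holds hL.p⟩
      MeetFilter.hasMinimalCovers MeetFilter.principal MeetFilter.principal_injective
      (fun _ => MeetFilter.isBot_principal) (fun _ => MeetFilter.isTop_principal)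
      (fun _ ha _ h => MeetFilter.eq_or_isBot_of_le_principal ha h) fun h => absurd h hfin

theorem SUBLO.chainIdentities (h : SUBLO L) : ChainIdentities L := by
  obtain ⟨I, T, _, φ, hφ⟩ := h
  exact ⟨(LatticeIdentity.Holds.pi fun _ => Co.holds_HS).of_injective φ hφ,
    (LatticeIdentity.Holds.pi fun _ => Co.holds_U).of_injective φ hφ,
    (LatticeIdentity.Holds.pi fun _ => Co.holds_B).of_injective φ hφ,
    (LatticeIdentity.Holds.pi fun _ => Co.holds_E).of_injective φ hφ,
    (LatticeIdentity.Holds.pi fun _ => Co.holds_P).of_injective φ hφ⟩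

theorem HasChainRepresentation.sublo (h : HasChainRepresentation L) : SUBLO L := by
  obtain ⟨I, T, inst, φ, hφ, -⟩ := h
  exact ⟨I, T, inst, φ, hφ⟩

theorem sublo_iff_chainIdentities : SUBLO L ↔ ChainIdentities L :=
  ⟨SUBLO.chainIdentities, fun h => h.hasChainRepresentation.sublo⟩

theorem chainIdentities_iff : ChainIdentities L ↔
    LatticeIdentity.HS.Holds L ∧ LatticeIdentity.U.Holds L ∧ LatticeIdentity.B.Holds L ∧
      LatticeIdentity.E.Holds L ∧ LatticeIdentity.P.Holds L :=
  ⟨fun h => ⟨h.hs, h.u, h.b, h.e, h.p⟩, fun h => ⟨h.1, h.2.1, h.2.2.1, h.2.2.2.1, h.2.2.2.2⟩⟩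

end Representation

theorem theorem7p1 :
    (∀ (L : Type u) [Lattice L], List.TFAE
      [ SUBLO L,
        LatticeIdentity.HS.Holds L ∧ LatticeIdentity.U.Holds L ∧ LatticeIdentity.B.Holds L ∧
          LatticeIdentity.E.Holds L ∧ LatticeIdentity.P.Holds L,
        ∃ (I : Type u) (T : I → Type u) (_ : ∀ i, LinearOrder (T i))
          (φ : LatticeHom L (∀ i, Co (T i))),
          Function.Injective φ ∧
          (∀ x : L, IsBot x → φ x = ⊥) ∧
          (∀ x : L, IsTop x → φ x = ⊤) ∧
          (Finite L → Cardinal.mk (Σ i, T i) ≤ Cardinal.mk (JoinIrr L) ^ 2) ∧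
          (SubdirectlyIrreducible L →
            (∃ i₀ : I, (∀ i, i = i₀) ∧
              (Finite L → Cardinal.mk (T i₀) = Cardinal.mk (JoinIrr L))) ∧
            (∀ a : L, IsLatticeAtom a → IsLatticeAtom (φ a))) ∧
          (Finite L → AtomisticLattice L → SubdirectlyIrreducible L →
            Nonempty (L ≃o Co (Fin (Nat.card (JoinIrr L))))) ]) ∧
    IsFinitelyBasedVariety.{u} SUBLO ∧
    (∀ (L M : Type u) [Lattice L] [Lattice M] (f : LatticeHom L M),
      Function.Surjective f → SUBLO L → SUBLO M) := by
  refine ⟨fun L _ => ?_, ⟨{LatticeIdentity.HS, LatticeIdentity.U, LatticeIdentity.B,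
    LatticeIdentity.E, LatticeIdentity.P}, Set.toFinite _, fun L _ => ?_⟩,
    fun L M _ _ f hf h => ?_⟩
  · tfae_have 1 → 2 := fun h => chainIdentities_iff.1 h.chainIdentities
    tfae_have 2 → 3 := fun h => (chainIdentities_iff.2 h).hasChainRepresentation
    tfae_have 3 → 1 := fun h => HasChainRepresentation.sublo h
    tfae_finish
  · simp [sublo_iff_chainIdentities, chainIdentities_iff]
  · have h := h.chainIdentities
    exact sublo_iff_chainIdentities.2 ⟨h.hs.of_surjective f hf, h.u.of_surjective f hf,
      h.b.of_surjective f hf, h.e.of_surjective f hf, h.p.of_surjective f hf⟩
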